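/- **Setting.** Let $\Gamma=(V_\Gamma,E_\Gamma)$ be a finite connected simple graph. Regard each edge as two oriented edges $pq,qp\in E_\Gamma$; for $e=pq$ put $i(e)=p$, and let $E^p$ be the set of oriented edges issuing from $p$. A $1$-skeleton $(\Gamma,\alpha,\theta,\lambda)$ in $\mathbb R^n$ consists of $\Gamma$ together with: bijections $\theta_{pq}\colon E^p\to E^q$ for $pq\in E_\Gamma$ with $\theta_{pq}(pq)=qp$ and $\theta_{qp}=\theta_{pq}^{-1}$; a map $\alpha\colon E_\Gamma\to\mathbb R^n$ with $\alpha(qp)=-\alpha(pq)$ whose values on each $E^p$ are pairwise linearly independent; and positive numbers $\lambda_e(e')$ for $e,e'\in E^p$, with $\lambda_e(e)=1$, such that $\alpha(e')-\lambda_e(e')\,\alpha(\theta_e(e'))\in\mathbb R\,\alpha(e)$. (Then $\Gamma$ has constant valency.) Put $S=\operatorname{Sym}(\mathbb R^n)$, and let $H(\Gamma,\alpha)$ be the $S$-algebra of all maps $f\colon V_\Gamma\to S$ with $f(q)-f(p)\in\alpha(pq)S$ for every $pq\in E_\Gamma$. For a $2$-dimensional subspace $P\subseteq\mathbb R^n$,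 the connected components of the graph with vertex set $V_\Gamma$ and oriented edges $\{e\in E_\Gamma:\alpha(e)\in P\}$, with the restricted data, are $1$-skeleta in $\mathbb R^n$, called $2$-slices. A covector $\xi\in(\mathbb R^n)^*$ is *generic polarizing* if $m_e:=\langle\xi,\alpha(e)\rangle\neq0$ for all $e\in E_\Gamma$; if the orientation of $\Gamma$ by the edges with $m_e>0$ has no oriented loops; and if, for each vertex $p$, the vectors $\alpha(e)/m_e-\alpha(e')/m_{e'}$, over ordered pairs $e\ne e'$ in $E^p$, are pairwise distinct. The *acyclicity axiom* says that some $\xi$ satisfies the first two conditions; a generic polarizing covector then exists. A ($\xi$-compatible) *Morse function* is an injective $\phi\colon V_\Gamma\to\mathbb R$ with $\phi(p)<\phi(q)$ whenever $m_{pq}>0$. Let $E^p_-=\{e\in E^p: m_e<0\}$. A *generating class* for $p$ is a $\tau_p\in H(\Gamma,\alpha)$, homogeneous of degree $\#E^p_-$, that vanishes at every vertex which is not the end of an oriented path starting at $p$ (the trivial path included), and satisfies $\tau_p(p)=\prod_{e\in E^p_-}\alpha(e)$. The $1$-skeleton has the *Morse package* if, for some generic polarizing covector, every vertex has a generating class.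 Now fix a generic polarizing $\xi$ for $\Gamma$ and a $\xi$-compatible Morse function $\phi$. Let $W_\xi=\ker\xi$ and $S_\xi=\operatorname{Sym}(W_\xi)$, and for $e\in E_\Gamma$ let $\rho_e\colon S\to S_\xi$ be the algebra map extending $v\mapsto v-\frac{\langle\xi,v\rangle}{m_e}\alpha(e)$. For a $\phi$-regular value $c\in\mathbb R\setminus\phi(V_\Gamma)$ let $V_c=\{pq\in E_\Gamma:\phi(p)<c<\phi(q)\}$, and for $f\colon V_\Gamma\to S$ define $\mathcal K_c(f)\colon V_c\to S_\xi$ by $\mathcal K_c(f)(e)=\rho_e(f(i(e)))$. Call non-zero real numbers $\{c_p\}_{p\in V_\Gamma}$ *integration constants* if $c_q=c_p\prod_{e\in E^p}\lambda_{pq}(e)$ for all $pq\in E_\Gamma$. Given such constants, put $$\int_{\Gamma_c}f=\sum_{e\in V_c}\frac{f(e)}{c_{i(e)}\,m_e\prod_{e'\in E^{i(e)},\,e'\ne e}\rho_e(\alpha(e'))}\in\operatorname{Frac}(S_\xi)\qquad(f\colon V_c\to S_\xi),$$ $$H(\Gamma_c)=\Big\{g\colon V_c\to S_\xi\ \Big|\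 \int_{\Gamma_c}g\cdot\mathcal K_c(h)\in S_\xi\ \text{ for all } h\in H(\Gamma,\alpha)\Big\}.$$ **Proposition 3.3 (with its corollary).** Let $(\Gamma,\alpha,\theta,\lambda)$ be a $1$-skeleton in $\mathbb R^n$ that satisfies the acyclicity axiom, and suppose that every $2$-slice has the Morse package. Let $\xi$ be a generic polarizing covector and $\phi$ a $\xi$-compatible Morse function. Then integration constants exist, and for every choice of them and every $\phi$-regular value $c$, the map $\mathcal K_c$ sends $H(\Gamma,\alpha)$ into $H(\Gamma_c)$, and the Kirwan map $\mathcal K_c\colon H(\Gamma,\alpha)\to H(\Gamma_c)$ is surjective. Consequently $H(\Gamma_c)$ is a subring (indeed an $S_\xi$-subalgebra) of $\operatorname{Maps}(V_c,S_\xi)$. -/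

import Mathlib

noncomputable section

/-- A `1`-skeleton `(Γ, α, θ, λ)` in `ℝⁿ` on the vertex set `V`.  Oriented edges are the ordered pairs
`(p, q)` of adjacent vertices, and an oriented edge issuing from `p` is recorded by its endpoint.  So
`α p q` is the direction of `pq`, the map `E^p → E^q` of the connection along `pq` sends `pr` to the
oriented edge from `q` to `θ p q r`, and `lam p q r` is the number `λ_{pq}(pr)`.  Only the values on
adjacent vertices matter.  Constant valency need not be required: the graph is connected, and
`θ_adj`, `θ_inv` make every map `E^p → E^q` a bijection. -/
structure OneSkeleton (n : ℕ) (V : Type*) where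
  graph : SimpleGraph V
  connected : graph.Connected
  α : V → V → (Fin n → ℝ)
  θ : V → V → V → V
  lam : V → V → V → ℝ
  θ_adj : ∀ p q r, graph.Adj p q → graph.Adj p r → graph.Adj q (θ p q r)
  θ_self : ∀ p q, graph.Adj p q → θ p q q = p
  θ_inv : ∀ p q r, graph.Adj p q → graph.Adj p r → θ q p (θ p q r) = r
  α_indep : ∀ p q r, graph.Adj p q → graph.Adj p r → q ≠ r →
    LinearIndependent ℝ ![α p q, α p r]
  α_symm : ∀ p q, graph.Adj p q → α p q = -α q p
  lam_pos : ∀ p q r, graph.Adj p q → graph.Adj p r → 0 < lam p q r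
  lam_self : ∀ p q, graph.Adj p q → lam p q q = 1
  α_compat : ∀ p q r, graph.Adj p q → graph.Adj p r →
    ∃ t : ℝ, α p r - lam p q r • α q (θ p q r) = t • α p q

namespace OneSkeleton

variable {n : ℕ} {V : Type*}

/-! ### Slices -/

/-- The graph `Γ_H`, whose oriented edges are those with direction in the subspace `H`. -/
def sliceGraph (Γ : OneSkeleton n V) (H : Submodule ℝ (Fin n → ℝ)) : SimpleGraph V where
  Adj p q := Γ.graph.Adj p q ∧ Γ.α p q ∈ H
  symm := ⟨fun p q h => ⟨h.1.symm, by
    rw [Γ.α_symm q p h.1.symm]; exact H.neg_mem h.2⟩⟩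
  loopless := ⟨fun p h => Γ.graph.loopless.irrefl p h.1⟩

theorem sliceGraph_θ_adj (Γ : OneSkeleton n V) (H : Submodule ℝ (Fin n → ℝ)) {p q r : V}
    (hq : (Γ.sliceGraph H).Adj p q) (hr : (Γ.sliceGraph H).Adj p r) :
    (Γ.sliceGraph H).Adj q (Γ.θ p q r) := by
  refine ⟨Γ.θ_adj p q r hq.1 hr.1, ?_⟩
  obtain ⟨t, ht⟩ := Γ.α_compat p q r hq.1 hr.1
  have h1 : Γ.lam p q r • Γ.α q (Γ.θ p q r) = Γ.α p r - t • Γ.α p q := by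
    rw [← ht]; abel
  have h2 : Γ.lam p q r • Γ.α q (Γ.θ p q r) ∈ H := by
    rw [h1]; exact H.sub_mem hr.2 (H.smul_mem t hq.2)
  exact (H.smul_mem_iff (Γ.lam_pos p q r hq.1 hr.1).ne').1 h2

open Classical in
/-- The slice of `Γ` on a connected component `C` of `Γ_H`, with the restricted data (the value of
`θ` is irrelevant where the vertices are not adjacent in the slice). -/
def slice (Γ : OneSkeleton n V) (H : Submodule ℝ (Fin n → ℝ))
    (C : (Γ.sliceGraph H).ConnectedComponent) : OneSkeleton n C where
  graph := C.toSimpleGraph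
  connected := C.connected_toSimpleGraph
  α p q := Γ.α p q
  θ p q r := if h : Γ.θ p q r ∈ C then ⟨Γ.θ p q r, h⟩ else p
  lam p q r := Γ.lam p q r
  θ_adj p q r hq hr := by
    have h := Γ.sliceGraph_θ_adj H (p := p) (q := q) (r := r) hq hr
    have hC : Γ.θ p q r ∈ C := C.mem_supp_of_adj_mem_supp q.2 h
    rw [dif_pos hC]
    exact h
  θ_self p q hq := by
    have h := Γ.θ_self p q hq.1
    have hC : Γ.θ p q q ∈ C := by rw [h]; exact p.2
    rw [dif_pos hC]
    exact Subtype.ext h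
  θ_inv p q r hq hr := by
    have h := Γ.sliceGraph_θ_adj H (p := p) (q := q) (r := r) hq hr
    have hC : Γ.θ p q r ∈ C := C.mem_supp_of_adj_mem_supp q.2 h
    have h' := Γ.θ_inv p q r hq.1 hr.1
    have hC' : Γ.θ q p (Γ.θ p q r) ∈ C := by rw [h']; exact r.2
    simp only [dif_pos hC, dif_pos hC']
    exact Subtype.ext h'
  α_indep p q r hq hr hne :=
    Γ.α_indep p q r hq.1 hr.1 fun h => hne (Subtype.ext h)
  α_symm p q hq := Γ.α_symm p q hq.1
  lam_pos p q r hq hr := Γ.lam_pos p q r hq.1 hr.1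
  lam_self p q hq := Γ.lam_self p q hq.1
  α_compat p q r hq hr := by
    have h := Γ.sliceGraph_θ_adj H (p := p) (q := q) (r := r) hq hr
    have hC : Γ.θ p q r ∈ C := C.mem_supp_of_adj_mem_supp q.2 h
    rw [dif_pos hC]
    exact Γ.α_compat p q r hq.1 hr.1

/-! ### Polarizations and Morse functions -/

/-- `pq` is an oriented edge in the orientation induced by `ξ`. -/
def Ascends (Γ : OneSkeleton n V) (ξ : (Fin n → ℝ) →ₗ[ℝ] ℝ) (p q : V) : Prop :=
  Γ.graph.Adj p q ∧ 0 < ξ (Γ.α p q)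

def IsPolarizing (Γ : OneSkeleton n V) (ξ : (Fin n → ℝ) →ₗ[ℝ] ℝ) : Prop :=
  ∀ p q, Γ.graph.Adj p q → ξ (Γ.α p q) ≠ 0

/-- The orientation induced by `ξ` has no oriented loops. -/
def IsAcyclic (Γ : OneSkeleton n V) (ξ : (Fin n → ℝ) →ₗ[ℝ] ℝ) : Prop :=
  ∀ p, ¬ Relation.TransGen (Γ.Ascends ξ) p p

/-- A generic polarizing covector; its induced orientation is always required to be acyclic, so its
existence contains the acyclicity axiom. -/
structure IsGenericPolarizing (Γ : OneSkeleton n V) (ξ : (Fin n → ℝ) →ₗ[ℝ] ℝ) : Prop where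
  polarizing : Γ.IsPolarizing ξ
  acyclic : Γ.IsAcyclic ξ
  /-- At each vertex, distinct ordered pairs of distinct edges have distinct differences. -/
  generic : ∀ p q₁ q₂ q₃ q₄, Γ.graph.Adj p q₁ → Γ.graph.Adj p q₂ → Γ.graph.Adj p q₃ →
    Γ.graph.Adj p q₄ → q₁ ≠ q₂ → q₃ ≠ q₄ → (q₁, q₂) ≠ (q₃, q₄) →
    (ξ (Γ.α p q₁))⁻¹ • Γ.α p q₁ - (ξ (Γ.α p q₂))⁻¹ • Γ.α p q₂ ≠
      (ξ (Γ.α p q₃))⁻¹ • Γ.α p q₃ - (ξ (Γ.α p q₄))⁻¹ • Γ.α p q₄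

/-- `φ` is a `ξ`-compatible Morse function. -/
structure IsMorseFunction (Γ : OneSkeleton n V) (ξ : (Fin n → ℝ) →ₗ[ℝ] ℝ) (φ : V → ℝ) : Prop where
  injective : Function.Injective φ
  increasing : ∀ p q, Γ.Ascends ξ p q → φ p < φ q

/-! ### Equivariant cohomology and the Morse package -/

/-- `S = Sym(ℝⁿ)`. -/
abbrev S (n : ℕ) : Type := SymmetricAlgebra ℝ (Fin n → ℝ)

/-- The inclusion of `ℝⁿ` in `S`, as the elements of degree one. -/
abbrev lin (v : Fin n → ℝ) : S n := SymmetricAlgebra.ι ℝ (Fin n → ℝ) v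

/-- The degree `k` part of `S`. -/
def homogeneousPart (n k : ℕ) : Submodule ℝ (S n) :=
  LinearMap.range (SymmetricAlgebra.ι ℝ (Fin n → ℝ)) ^ k

/-- `H(Γ, α)`. -/
def cohomology (Γ : OneSkeleton n V) : Subalgebra (S n) (V → S n) where
  carrier := {f | ∀ p q, Γ.graph.Adj p q → f q - f p ∈ Ideal.span {lin (Γ.α p q)}}
  mul_mem' := by
    intro f g hf hg p q h
    have e : (f * g) q - (f * g) p = f q * (g q - g p) + g p * (f q - f p) := by
      simp only [Pi.mul_apply]; ring
    rw [e]
    exact Ideal.add_mem _ (Ideal.mul_mem_left _ _ (hg p q h)) (Ideal.mul_mem_left _ _ (hf p q h))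
  add_mem' := by
    intro f g hf hg p q h
    have e : (f + g) q - (f + g) p = (f q - f p) + (g q - g p) := by
      simp only [Pi.add_apply]; ring
    rw [e]
    exact Ideal.add_mem _ (hf p q h) (hg p q h)
  algebraMap_mem' := by
    intro s p q _
    simp

variable [Finite V]

/-- The vertices joined to `p`, that is, `E^p`. -/
def nbrs (Γ : OneSkeleton n V) (p : V) : Finset V :=
  (Set.toFinite {q | Γ.graph.Adj p q}).toFinset

/-- `E^p_-`, the edges at `p` that flow into `p`. -/
def downNbrs (Γ : OneSkeleton n V) (ξ : (Fin n → ℝ) →ₗ[ℝ] ℝ) (p : V) : Finset V :=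
  (Set.toFinite {q | Γ.graph.Adj p q ∧ ξ (Γ.α p q) < 0}).toFinset

/-- The index of `p` with respect to `ξ`. -/
def index (Γ : OneSkeleton n V) (ξ : (Fin n → ℝ) →ₗ[ℝ] ℝ) (p : V) : ℕ :=
  (Γ.downNbrs ξ p).card

/-- `τ` is a generating class for `p`. -/
structure IsGeneratingClass (Γ : OneSkeleton n V) (ξ : (Fin n → ℝ) →ₗ[ℝ] ℝ) (p : V)
    (τ : V → S n) : Prop where
  mem : τ ∈ Γ.cohomology
  homogeneous : ∀ x, τ x ∈ homogeneousPart n (Γ.index ξ p)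
  support : ∀ x, τ x ≠ 0 → Relation.ReflTransGen (Γ.Ascends ξ) p x
  self : τ p = ∏ q ∈ Γ.downNbrs ξ p, lin (Γ.α p q)

/-- `Γ` has the Morse package: for some generic polarizing covector there is a generating family. -/
def HasMorsePackage (Γ : OneSkeleton n V) : Prop :=
  ∃ ξ : (Fin n → ℝ) →ₗ[ℝ] ℝ, Γ.IsGenericPolarizing ξ ∧
    ∃ τ : V → V → S n, ∀ p, Γ.IsGeneratingClass ξ p (τ p)

/-! ### The Kirwan map and the cross-sectional cohomology -/

/-- `S_ξ = Sym(W_ξ)` for the annihilator hyperplane `W_ξ` of `ξ`. -/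
abbrev Sperp (ξ : (Fin n → ℝ) →ₗ[ℝ] ℝ) : Type := SymmetricAlgebra ℝ (LinearMap.ker ξ)

/-- The projection `x ↦ x - (⟨ξ, x⟩ / ⟨ξ, a⟩) a` of `ℝⁿ` to `W_ξ` along `a`. -/
def proj (ξ : (Fin n → ℝ) →ₗ[ℝ] ℝ) (a : Fin n → ℝ) (ha : ξ a ≠ 0) :
    (Fin n → ℝ) →ₗ[ℝ] LinearMap.ker ξ :=
  LinearMap.codRestrict (LinearMap.ker ξ)
    (LinearMap.id - ((ξ a)⁻¹ • ξ).smulRight a) (by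
      intro x
      simp only [LinearMap.mem_ker, LinearMap.sub_apply, LinearMap.id_apply,
        LinearMap.smulRight_apply, LinearMap.smul_apply, map_sub, map_smul, smul_eq_mul]
      field_simp
      ring)

/-- The algebra map `ρ_e : S → S_ξ` for the oriented edge `e = pq`. -/
def rho (Γ : OneSkeleton n V) {ξ : (Fin n → ℝ) →ₗ[ℝ] ℝ} (hξ : Γ.IsPolarizing ξ) {p q : V}
    (h : Γ.graph.Adj p q) : S n →ₐ[ℝ] Sperp ξ :=
  SymmetricAlgebra.lift (SymmetricAlgebra.ι ℝ (LinearMap.ker ξ) ∘ₗ proj ξ (Γ.α p q) (hξ p q h))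

/-- `V_c`, the oriented edges that cross the level `c`. -/
abbrev CrossVertex (Γ : OneSkeleton n V) (φ : V → ℝ) (c : ℝ) : Type _ :=
  {e : V × V // Γ.graph.Adj e.1 e.2 ∧ φ e.1 < c ∧ c < φ e.2}

instance (Γ : OneSkeleton n V) (φ : V → ℝ) (c : ℝ) : Fintype (Γ.CrossVertex φ c) :=
  Fintype.ofFinite _

/-- `K_c`, on all of `Maps(V, S)`. -/
def kirwan (Γ : OneSkeleton n V) {ξ : (Fin n → ℝ) →ₗ[ℝ] ℝ} (hξ : Γ.IsPolarizing ξ) (φ : V → ℝ)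
    (c : ℝ) (f : V → S n) : Γ.CrossVertex φ c → Sperp ξ :=
  fun e => Γ.rho hξ e.2.1 (f e.1.1)

/-- The constants that enter the integral operators: non-zero numbers `k p` with
`k q = k p ∏_{e ∈ E^p} λ_{pq}(e)` for each oriented edge `pq`. -/
structure IsIntegrationConstants (Γ : OneSkeleton n V) (k : V → ℝ) : Prop where
  ne_zero : ∀ p, k p ≠ 0
  cocycle : ∀ p q, Γ.graph.Adj p q → k q = k p * ∏ r ∈ Γ.nbrs p, Γ.lam p q r

open Classical in
/-- The cross-sectional integral operator, with values in the field of fractions of `S_ξ`. -/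
def crossIntegral (Γ : OneSkeleton n V) {ξ : (Fin n → ℝ) →ₗ[ℝ] ℝ} (hξ : Γ.IsPolarizing ξ)
    (φ : V → ℝ) (k : V → ℝ) (c : ℝ) (f : Γ.CrossVertex φ c → Sperp ξ) :
    FractionRing (Sperp ξ) :=
  ∑ e : Γ.CrossVertex φ c, algebraMap (Sperp ξ) (FractionRing (Sperp ξ)) (f e) /
    algebraMap (Sperp ξ) (FractionRing (Sperp ξ))
      (algebraMap ℝ (Sperp ξ) (k e.1.1 * ξ (Γ.α e.1.1 e.1.2)) *
        ∏ r ∈ (Γ.nbrs e.1.1).erase e.1.2, Γ.rho hξ e.2.1 (lin (Γ.α e.1.1 r)))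

/-- `H(Γ_c)`. -/
def crossCohomology (Γ : OneSkeleton n V) {ξ : (Fin n → ℝ) →ₗ[ℝ] ℝ} (hξ : Γ.IsPolarizing ξ)
    (φ : V → ℝ) (k : V → ℝ) (c : ℝ) : Set (Γ.CrossVertex φ c → Sperp ξ) :=
  {g | ∀ h ∈ Γ.cohomology, Γ.crossIntegral hξ φ k c (g * Γ.kirwan hξ φ c h) ∈
    Set.range (algebraMap (Sperp ξ) (FractionRing (Sperp ξ)))}

end OneSkeleton

end

/-!
The proof rests on one extension principle: a family of values on a set of vertices that is closed
downward for the Morse function, if it satisfies the congruences along the edges inside that set,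
extends to a class in `H(Γ, α)`.

For a `2`-slice the principle follows from the Morse package, even though that is given for some
other covector `ξ'`. The generating family for `ξ'` bounds the dimension of the cohomology in each
degree from below. The possible values of classes that vanish below a vertex `p`, which are
divisible by the product of the edges that flow into `p`, bound it from above. The two bounds
agree, since the number of vertices of each index is the same for all polarizing covectors
(`sum_index_eq`, by crossing one wall at a time). Hence each such product is the value at `p` of a
class that vanishes below `p` (`HasMorsePackage.exists_isLeadingClass`), and partial classes are
combinations of these.

For `Γ` itself, a class is extended across one vertex `q` at a time. This asks for a polynomial
with given values modulo the edges that flow into `q`. Within each plane it is supplied by a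
slice, and that is enough: when a new linear form is added to those already interpolated, the
obstruction is a divisibility in a polynomial ring, where forms from different planes are
relatively prime (`exists_interpolation_of_planes`).

Integration constants come from the Thom classes of vertices. Those of adjacent vertices are
proportional modulo the positive degree part of `S`, and at the topmost vertex this class is an
element of a basis of `H(Γ, α)`, so some functional is non-zero on all of them.

The integral over a cut is a sum of residues: the contributions of the two orientations of an edge
cancel, and the residues of a polynomial at a vertex add up to a polynomial
(`IsTransverseFamily.residueSum_along_mem`). So the Kirwan map lands in `H(Γ_c)`. Surjectivity is
proved by moving the cut across its top vertex `a`. Given `g` on the upper cut, integration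
against classes that vanish below `a` shows that the values of `g` on the edges leaving `a` upward
come from one polynomial `F`. With the values of `F` on the edges from below to `a`, the function
`g` becomes an element for the lower cut, because the integrals change by the residues at `a`
only. By induction it is the image of a class, which is given the value `F` at `a` and extended.
-/

noncomputable section

namespace OneSkeleton

/-! ### Linear forms in symmetric algebras -/

section LinearForms

open SymmetricAlgebra Module

variable {M : Type*} [AddCommGroup M] [Module ℝ M]

instance : UniqueFactorizationMonoid (SymmetricAlgebra ℝ M) :=
  (equivMvPolynomial (Basis.ofVectorSpace ℝ M)).symm.toMulEquiv.uniqueFactorizationMonoid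
    inferInstance

/-- A nonzero vector is part of a basis, hence a variable of a polynomial ring. -/
theorem prime_ι {v : M} (hv : v ≠ 0) : Prime (ι ℝ M v) := by
  have hli : LinearIndepOn ℝ id ({v} : Set M) := LinearIndepOn.singleton hv
  let b := Basis.extend hli
  have hmem : v ∈ hli.extend (Set.subset_univ _) :=
    hli.subset_extend _ (Set.mem_singleton v)
  have hb : b ⟨v, hmem⟩ = v := by simp [b]
  rw [← MulEquiv.prime_iff (equivMvPolynomial b).toMulEquiv]
  have : (equivMvPolynomial b).toMulEquiv (ι ℝ M v) = MvPolynomial.X ⟨v, hmem⟩ := by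
    have h := equivMvPolynomial_ι_apply b ⟨v, hmem⟩
    rwa [hb] at h
  rw [this]
  exact MvPolynomial.X_prime

theorem ι_eq_zero_iff {v : M} : ι ℝ M v = 0 ↔ v = 0 :=
  ⟨fun h => by_contra fun hv => (prime_ι hv).ne_zero h, fun h => by rw [h, map_zero]⟩

theorem mem_span_of_ι_dvd_ι {v w : M} (h : ι ℝ M v ∣ ι ℝ M w) : w ∈ Submodule.span ℝ {v} := by
  let π := (Submodule.span ℝ {v}).mkQ
  have h1 : lift (ι ℝ _ ∘ₗ π) (ι ℝ M v) = 0 := by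
    rw [lift_ι_apply, LinearMap.comp_apply, ι_eq_zero_iff]
    simp [π]
  have h2 : lift (ι ℝ _ ∘ₗ π) (ι ℝ M w) = 0 := by
    have := map_dvd (lift (ι ℝ _ ∘ₗ π)) h
    rw [h1] at this
    exact zero_dvd_iff.1 this
  rw [lift_ι_apply, LinearMap.comp_apply, ι_eq_zero_iff] at h2
  simpa [π] using h2

theorem isRelPrime_ι {v w : M} (hv : v ≠ 0) (h : w ∉ Submodule.span ℝ {v}) :
    IsRelPrime (ι ℝ M v) (ι ℝ M w) :=
  (prime_ι hv).irreducible.isRelPrime_iff_not_dvd.2 fun hd => h (mem_span_of_ι_dvd_ι hd)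

end LinearForms

/-! ### Projection along a vector transverse to a hyperplane -/

section Along

variable {n : ℕ}

/-- The algebra map `Sym(ℝⁿ) → Sym(ker ξ)` induced by the projection along `a`, as a total function
of `a`: the value is irrelevant when `ξ a = 0`. -/
def along (ξ : (Fin n → ℝ) →ₗ[ℝ] ℝ) (a : Fin n → ℝ) : S n →ₐ[ℝ] Sperp ξ :=
  open Classical in
  SymmetricAlgebra.lift (SymmetricAlgebra.ι ℝ (LinearMap.ker ξ) ∘ₗ
    (if ha : ξ a ≠ 0 then proj ξ a ha else 0))

/-- The inclusion `Sym(ker ξ) → Sym(ℝⁿ)`, a section of every projection `along ξ a`. -/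
def incl (ξ : (Fin n → ℝ) →ₗ[ℝ] ℝ) : Sperp ξ →ₐ[ℝ] S n :=
  SymmetricAlgebra.lift (SymmetricAlgebra.ι ℝ (Fin n → ℝ) ∘ₗ (LinearMap.ker ξ).subtype)

variable {ξ : (Fin n → ℝ) →ₗ[ℝ] ℝ} {a : Fin n → ℝ}

theorem along_lin (ha : ξ a ≠ 0) (v : Fin n → ℝ) :
    along ξ a (lin v) = SymmetricAlgebra.ι ℝ (LinearMap.ker ξ) (proj ξ a ha v) := by
  simp [along, lin, ha]

theorem proj_coe (ha : ξ a ≠ 0) (v : Fin n → ℝ) :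
    (proj ξ a ha v : Fin n → ℝ) = v - ((ξ a)⁻¹ * ξ v) • a := by
  simp [proj]

theorem proj_eq_zero_iff (ha : ξ a ≠ 0) {v : Fin n → ℝ} :
    proj ξ a ha v = 0 ↔ v ∈ Submodule.span ℝ {a} := by
  rw [← Subtype.coe_inj, proj_coe, Submodule.mem_span_singleton]
  constructor
  · intro h
    exact ⟨_, (sub_eq_zero.1 h).symm⟩
  · rintro ⟨t, rfl⟩
    simp only [map_smul, smul_eq_mul, ZeroMemClass.coe_zero]
    rw [mul_left_comm, inv_mul_cancel₀ ha, mul_one, sub_self]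

theorem along_self (ha : ξ a ≠ 0) : along ξ a (lin a) = 0 := by
  rw [along_lin ha, ι_eq_zero_iff, proj_eq_zero_iff]
  exact Submodule.mem_span_singleton_self a

theorem along_lin_ne_zero (ha : ξ a ≠ 0) {v : Fin n → ℝ} (h : v ∉ Submodule.span ℝ {a}) :
    along ξ a (lin v) ≠ 0 := by
  rw [along_lin ha, Ne, ι_eq_zero_iff, proj_eq_zero_iff]
  exact h

theorem along_incl (ha : ξ a ≠ 0) (s : Sperp ξ) : along ξ a (incl ξ s) = s := by
  have : (along ξ a).comp (incl ξ) = AlgHom.id ℝ (Sperp ξ) := by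
    refine SymmetricAlgebra.algHom_ext (LinearMap.ext fun w => ?_)
    have hw : ξ (w : Fin n → ℝ) = 0 := w.2
    have h2 : proj ξ a ha w = w := Subtype.ext (by rw [proj_coe, hw]; simp)
    have h1 := along_lin ha (w : Fin n → ℝ)
    rw [h2] at h1
    simpa [incl] using h1
  exact DFunLike.congr_fun this s

theorem lin_dvd_sub_incl_along (ha : ξ a ≠ 0) (x : S n) :
    lin a ∣ x - incl ξ (along ξ a x) := by
  rw [← Ideal.mem_span_singleton, ← Ideal.Quotient.mk_eq_mk_iff_sub_mem]
  have : (Ideal.Quotient.mkₐ ℝ (Ideal.span {lin a})).comp ((incl ξ).comp (along ξ a)) =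
      Ideal.Quotient.mkₐ ℝ (Ideal.span {lin a}) := by
    refine SymmetricAlgebra.algHom_ext (LinearMap.ext fun v => ?_)
    have h1 : incl ξ (along ξ a (lin v)) = lin (v - ((ξ a)⁻¹ * ξ v) • a) := by
      rw [along_lin ha, ← proj_coe ha]; simp [incl]
    change Ideal.Quotient.mk _ (incl ξ (along ξ a (lin v))) = Ideal.Quotient.mk _ (lin v)
    rw [h1, Ideal.Quotient.mk_eq_mk_iff_sub_mem, Ideal.mem_span_singleton]
    refine ⟨- algebraMap ℝ _ ((ξ a)⁻¹ * ξ v), ?_⟩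
    rw [lin, map_sub, map_smul, Algebra.smul_def]
    ring
  exact (DFunLike.congr_fun this x).symm

/-- The kernel of the projection along `a` is generated by `a`. -/
theorem along_eq_zero_iff (ha : ξ a ≠ 0) {x : S n} : along ξ a x = 0 ↔ lin a ∣ x := by
  constructor
  · intro h
    simpa [h] using lin_dvd_sub_incl_along ha x
  · rintro ⟨y, rfl⟩
    rw [map_mul, along_self ha, zero_mul]

theorem along_eq_iff (ha : ξ a ≠ 0) {x y : S n} :
    along ξ a x = along ξ a y ↔ x - y ∈ Ideal.span {lin a} := by
  rw [Ideal.mem_span_singleton, ← along_eq_zero_iff ha, map_sub, sub_eq_zero]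

theorem ne_zero_of_apply_ne_zero (ha : ξ a ≠ 0) : a ≠ 0 := by
  rintro rfl
  exact ha (map_zero ξ)

end Along

/-! ### Interpolation along linear forms, from planes to the whole space -/

section Interpolation

variable {n : ℕ} {ι : Type*}

/-- Grouping linear forms into proportionality classes: if `y` is divisible by the product of each
class, then it is divisible by the product of all the forms, as products over distinct classes are
relatively prime. -/
theorem prod_dvd_of_forall_class_dvd {R κ : Type*} [CommRing R] [IsDomain R]
    [UniqueFactorizationMonoid R] [DecidableEq κ] (T : Finset ι) (u : ι → R) (cl : ι → κ) (y : R)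
    (hrel : ∀ i ∈ T, ∀ j ∈ T, cl i ≠ cl j → IsRelPrime (u i) (u j))
    (h : ∀ i ∈ T, (∏ j ∈ T with cl j = cl i, u j) ∣ y) : (∏ i ∈ T, u i) ∣ y := by
  rw [← Finset.prod_fiberwise_of_maps_to (t := T.image cl)
    (fun i hi => Finset.mem_image_of_mem cl hi)]
  apply Finset.prod_dvd_of_isRelPrime
  · intro k _ l _ hkl
    refine IsRelPrime.prod_left fun i hi => IsRelPrime.prod_right fun j hj => ?_
    simp only [Finset.mem_filter] at hi hj
    exact hrel i hi.1 j hj.1 (by rw [hi.2, hj.2]; exact hkl)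
  · intro k hk
    obtain ⟨i, hi, rfl⟩ := Finset.mem_image.1 hk
    exact h i hi

variable {ξ : (Fin n → ℝ) →ₗ[ℝ] ℝ}

theorem prod_lin_dvd {T : Finset ι} {a : ι → Fin n → ℝ} (h0 : ∀ i ∈ T, a i ≠ 0)
    (hind : ∀ i ∈ T, ∀ j ∈ T, i ≠ j → a j ∉ Submodule.span ℝ {a i}) {y : S n}
    (h : ∀ i ∈ T, lin (a i) ∣ y) : (∏ i ∈ T, lin (a i)) ∣ y :=
  Finset.prod_dvd_of_isRelPrime
    (fun i hi j hj hij => isRelPrime_ι (h0 i hi) (hind i hi j hj hij)) h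

theorem mem_span_pair_iff_of_notMem {M : Type*} [AddCommGroup M] [Module ℝ M] {a b c : M}
    (hb : b ∉ Submodule.span ℝ {a}) (hc : c ∉ Submodule.span ℝ {a}) :
    c ∈ Submodule.span ℝ {a, b} ↔ Submodule.span ℝ {a, c} = Submodule.span ℝ {a, b} := by
  constructor
  · intro h
    apply le_antisymm
    · rw [Submodule.span_le]
      rintro x (rfl | rfl)
      · exact Submodule.subset_span (by simp)
      · exact h
    · rw [Submodule.span_le]
      rintro x (rfl | rfl)
      · exact Submodule.subset_span (by simp)
      · rw [Set.pair_comm] at h ⊢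
        exact mem_span_insert_exchange h hc
  · intro h
    rw [← h]
    exact Submodule.subset_span (by simp)

/-- Values prescribed modulo pairwise independent linear forms `a i` are taken by one polynomial as
soon as this holds for the forms in each plane.  Adding the form `a m` to forms already
interpolated by `F` amounts to a divisibility by the product of the other forms modulo `a m`, and
modulo `a m` two forms are proportional exactly if they span the same plane with `a m`. -/
theorem exists_interpolation_of_planes {T : Finset ι} {a : ι → Fin n → ℝ} {f : ι → S n}
    (h0 : ∀ i ∈ T, ξ (a i) ≠ 0)
    (hind : ∀ i ∈ T, ∀ j ∈ T, i ≠ j → a j ∉ Submodule.span ℝ {a i})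
    (hplane : ∀ i ∈ T, ∀ j ∈ T, i ≠ j → ∃ F : S n, ∀ k ∈ T,
      a k ∈ Submodule.span ℝ {a i, a j} → lin (a k) ∣ F - f k) :
    ∃ F : S n, ∀ k ∈ T, lin (a k) ∣ F - f k := by
  classical
  induction T using Finset.induction_on with
  | empty => exact ⟨0, by simp⟩
  | insert m T hm ih =>
    have hsub : ∀ {i}, i ∈ T → i ∈ insert m T := fun h => Finset.mem_insert_of_mem h
    have hmm : m ∈ insert m T := Finset.mem_insert_self m T
    obtain ⟨F, hF⟩ := ih (fun i hi => h0 i (hsub hi))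
      (fun i hi j hj => hind i (hsub hi) j (hsub hj))
      (fun i hi j hj hij => by
        obtain ⟨F, hF⟩ := hplane i (hsub hi) j (hsub hj) hij
        exact ⟨F, fun k hk => hF k (hsub hk)⟩)
    have hξm := h0 m hmm
    have hne : ∀ {i}, i ∈ T → m ≠ i := fun hi => by rintro rfl; exact hm hi
    have hmi : ∀ i ∈ T, a i ∉ Submodule.span ℝ {a m} := fun i hi =>
      hind m hmm i (hsub hi) (hne hi)
    have hdvd : (∏ i ∈ T, along ξ (a m) (lin (a i))) ∣ along ξ (a m) (f m - F) := by
      apply prod_dvd_of_forall_class_dvd T _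
        (fun i => Submodule.span ℝ {a m, a i})
      · intro i hi j hj hij
        rw [along_lin hξm, along_lin hξm]
        refine isRelPrime_ι (by rw [Ne, proj_eq_zero_iff]; exact hmi i hi) fun hmem => ?_
        obtain ⟨t, ht⟩ := Submodule.mem_span_singleton.1 hmem
        refine hij ((mem_span_pair_iff_of_notMem (hmi j hj) (hmi i hi)).1 ?_)
        have h1 : a j - t • a i ∈ Submodule.span ℝ {a m} := by
          rw [← proj_eq_zero_iff hξm, map_sub, map_smul, ht, sub_self]
        obtain ⟨s, hs⟩ := Submodule.mem_span_singleton.1 h1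
        have h2 : a j ∈ Submodule.span ℝ {a m, a i} := by
          rw [Submodule.mem_span_pair]
          exact ⟨s, t, by rw [hs]; abel⟩
        rw [mem_span_pair_iff_of_notMem (hmi i hi) (hmi j hj)] at h2
        rw [h2]
        exact Submodule.subset_span (by simp)
      · intro i hi
        obtain ⟨G, hG⟩ := hplane m hmm i (hsub hi) (hne hi)
        have h1 : along ξ (a m) (f m - F) = along ξ (a m) (G - F) := by
          have h := hG m hmm (Submodule.subset_span (by simp))
          rw [← along_eq_zero_iff hξm] at h
          rw [show f m - F = (G - F) - (G - f m) by ring, map_sub, h, sub_zero]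
        rw [h1, ← map_prod]
        apply map_dvd
        apply prod_lin_dvd
        · intro j hj
          exact ne_zero_of_apply_ne_zero (h0 j (hsub (Finset.mem_filter.1 hj).1))
        · intro j hj k hk
          exact hind j (hsub (Finset.mem_filter.1 hj).1) k (hsub (Finset.mem_filter.1 hk).1)
        · intro j hj
          obtain ⟨hjT, hj⟩ := Finset.mem_filter.1 hj
          have h2 := hG j (hsub hjT) (by
            rw [← hj]; exact Submodule.subset_span (by simp))
          have h3 := hF j hjT
          have := dvd_sub h2 h3
          rwa [show G - f j - (F - f j) = G - F by ring] at this
    obtain ⟨g, hg⟩ := hdvd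
    refine ⟨F + (∏ i ∈ T, lin (a i)) * incl ξ g, fun k hk => ?_⟩
    rcases Finset.mem_insert.1 hk with rfl | hk
    · rw [← along_eq_zero_iff hξm, map_sub, map_add, map_mul, along_incl hξm, map_prod, ← hg,
        ← map_add, ← map_sub, show F + (f k - F) - f k = 0 by ring, map_zero]
    · rw [show F + (∏ i ∈ T, lin (a i)) * incl ξ g - f k =
        (F - f k) + (∏ i ∈ T, lin (a i)) * incl ξ g by ring]
      exact dvd_add (hF k hk) (Dvd.dvd.mul_right (Finset.dvd_prod_of_mem _ hk) _)

end Interpolation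

/-! ### Residues and interpolation on a transverse line -/

section Residues

variable {n : ℕ} {ι : Type*}

/-- The denominator at `i` of the sum of residues attached to the vectors `a j`, `j ∈ U`. -/
def residueDen [DecidableEq ι] (ξ : (Fin n → ℝ) →ₗ[ℝ] ℝ) (a : ι → Fin n → ℝ) (U : Finset ι)
    (i : ι) : Sperp ξ :=
  algebraMap ℝ (Sperp ξ) (ξ (a i)) * ∏ j ∈ U.erase i, along ξ (a i) (lin (a j))

/-- The sum over `i ∈ U` of the residues with numerators `g i`.  If `Sym(ℝⁿ)` is regarded as a
polynomial ring in one variable over `Sym(ker ξ)`, this is, up to a scalar, the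
coefficient in degree `#U - 1` of the polynomial of degree less than `#U` that interpolates `g` at
the roots of the linear polynomials `a i`.  The values lie in a fraction field `K` of `Sym(ker ξ)`. -/
def residueSum [DecidableEq ι] (ξ : (Fin n → ℝ) →ₗ[ℝ] ℝ) (K : Type*) [Field K]
    [Algebra (Sperp ξ) K] (a : ι → Fin n → ℝ) (U : Finset ι) (g : ι → Sperp ξ) : K :=
  ∑ i ∈ U, algebraMap (Sperp ξ) K (g i) / algebraMap (Sperp ξ) K (residueDen ξ a U i)

variable {ξ : (Fin n → ℝ) →ₗ[ℝ] ℝ} {a : ι → Fin n → ℝ} {U : Finset ι}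

/-- The vectors `a i`, `i ∈ U`, are transverse to the kernel of `ξ` and pairwise independent. -/
structure IsTransverseFamily (ξ : (Fin n → ℝ) →ₗ[ℝ] ℝ) (a : ι → Fin n → ℝ) (U : Finset ι) :
    Prop where
  apply_ne_zero : ∀ i ∈ U, ξ (a i) ≠ 0
  notMem_span : ∀ i ∈ U, ∀ j ∈ U, i ≠ j → a j ∉ Submodule.span ℝ {a i}

theorem IsTransverseFamily.mono (h : IsTransverseFamily ξ a U) {U' : Finset ι} (hU : U' ⊆ U) :
    IsTransverseFamily ξ a U' :=
  ⟨fun i hi => h.1 i (hU hi), fun i hi j hj => h.2 i (hU hi) j (hU hj)⟩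

theorem algebraMap_sperp_ne_zero {t : ℝ} (ht : t ≠ 0) : algebraMap ℝ (Sperp ξ) t ≠ 0 :=
  (map_ne_zero_iff _ (algebraMap ℝ (Sperp ξ)).injective).2 ht

theorem IsTransverseFamily.along_ne_zero (h : IsTransverseFamily ξ a U) {i j : ι} (hi : i ∈ U)
    (hj : j ∈ U) (hij : i ≠ j) : along ξ (a i) (lin (a j)) ≠ 0 :=
  along_lin_ne_zero (h.1 i hi) (h.2 i hi j hj hij)

variable [DecidableEq ι]

theorem IsTransverseFamily.residueDen_ne_zero (h : IsTransverseFamily ξ a U) {i : ι} (hi : i ∈ U) :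
    residueDen ξ a U i ≠ 0 := by
  refine mul_ne_zero (algebraMap_sperp_ne_zero (h.1 i hi)) (Finset.prod_ne_zero_iff.2 ?_)
  intro j hj
  rw [Finset.mem_erase] at hj
  exact h.along_ne_zero hi hj.2 hj.1.symm

variable {K : Type*} [Field K] [Algebra (Sperp ξ) K]

theorem residueSum_congr {g g' : ι → Sperp ξ} (h : ∀ i ∈ U, g i = g' i) :
    residueSum ξ K a U g = residueSum ξ K a U g' :=
  Finset.sum_congr rfl fun i hi => by rw [h i hi]

theorem residueSum_add (g g' : ι → Sperp ξ) :
    residueSum ξ K a U (fun i => g i + g' i) = residueSum ξ K a U g + residueSum ξ K a U g' := by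
  simp only [residueSum, map_add, add_div, Finset.sum_add_distrib]

theorem residueSum_sub (g g' : ι → Sperp ξ) :
    residueSum ξ K a U (fun i => g i - g' i) = residueSum ξ K a U g - residueSum ξ K a U g' := by
  simp only [residueSum, map_sub, sub_div, Finset.sum_sub_distrib]

theorem residueSum_mul (s : Sperp ξ) (g : ι → Sperp ξ) :
    residueSum ξ K a U (fun i => s * g i) =
      algebraMap _ K s * residueSum ξ K a U g := by
  simp only [residueSum, map_mul, mul_div_assoc, Finset.mul_sum]

theorem residueSum_singleton_one {u : ι} (hu : ξ (a u) ≠ 0) :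
    residueSum ξ K a {u} (fun _ => 1) =
      algebraMap (Sperp ξ) _ (algebraMap ℝ (Sperp ξ) (ξ (a u))⁻¹) := by
  rw [residueSum, Finset.sum_singleton, residueDen]
  simp only [Finset.erase_singleton, Finset.prod_empty, mul_one, map_one, one_div]
  apply inv_eq_of_mul_eq_one_right
  rw [← map_mul, ← map_mul, mul_inv_cancel₀ hu, map_one, map_one]

variable [IsFractionRing (Sperp ξ) K]

theorem algebraMap_fractionRing_ne_zero {s : Sperp ξ} (hs : s ≠ 0) :
    algebraMap (Sperp ξ) K s ≠ 0 :=
  (map_ne_zero_iff _ (IsFractionRing.injective _ _)).2 hs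

/-- A factor `a u` in the numerators removes `u` from the sum of residues. -/
theorem IsTransverseFamily.residueSum_lin_mul (h : IsTransverseFamily ξ a U) {u : ι} (hu : u ∈ U)
    (g : ι → Sperp ξ) :
    residueSum ξ K a U (fun i => along ξ (a i) (lin (a u)) * g i) =
      residueSum ξ K a (U.erase u) g := by
  rw [residueSum, ← Finset.add_sum_erase U _ hu, along_self (h.1 u hu), zero_mul, map_zero,
    zero_div, zero_add]
  refine Finset.sum_congr rfl fun i hi => ?_
  rw [Finset.mem_erase] at hi
  have hden : residueDen ξ a U i =
      along ξ (a i) (lin (a u)) * residueDen ξ a (U.erase u) i := by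
    rw [residueDen, residueDen, ← Finset.mul_prod_erase (U.erase i) _
      (Finset.mem_erase.2 ⟨hi.1.symm, hu⟩), Finset.erase_right_comm]
    ring
  rw [hden, map_mul, map_mul, mul_div_mul_left]
  exact algebraMap_fractionRing_ne_zero (h.along_ne_zero hi.2 hu hi.1)

/-- The residues of a constant sum to zero as soon as there are at least two of them. -/
theorem IsTransverseFamily.residueSum_one_eq_zero (h : IsTransverseFamily ξ a U)
    (hU : 2 ≤ U.card) : residueSum ξ K a U (fun _ => 1) = 0 := by
  induction hN : U.card using Nat.strong_induction_on generalizing U with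
  | _ N ih =>
    obtain ⟨u, hu, v, hv, huv⟩ := Finset.one_lt_card.1 hU
    -- the combination of `a u` and `a v` on which `ξ` vanishes
    let w : LinearMap.ker ξ := ⟨ξ (a v) • a u - ξ (a u) • a v, by
      simp only [LinearMap.mem_ker, map_sub, map_smul, smul_eq_mul]; ring⟩
    have hw : SymmetricAlgebra.ι ℝ (LinearMap.ker ξ) w ≠ 0 := by
      rw [Ne, ι_eq_zero_iff]
      intro h0
      have h1 : ξ (a v) • a u - ξ (a u) • a v = 0 := congrArg Subtype.val h0
      refine h.2 u hu v hv huv (Submodule.mem_span_singleton.2 ⟨(ξ (a u))⁻¹ * ξ (a v), ?_⟩)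
      rw [mul_smul, sub_eq_zero.1 h1, smul_smul, inv_mul_cancel₀ (h.1 u hu), one_smul]
    have key : algebraMap (Sperp ξ) K
        (SymmetricAlgebra.ι ℝ (LinearMap.ker ξ) w) * residueSum ξ K a U (fun _ => 1) =
        algebraMap (Sperp ξ) _ (algebraMap ℝ (Sperp ξ) (ξ (a v))) *
          residueSum ξ K a (U.erase u) (fun _ => 1) -
        algebraMap (Sperp ξ) _ (algebraMap ℝ (Sperp ξ) (ξ (a u))) *
          residueSum ξ K a (U.erase v) (fun _ => 1) := by
      rw [← residueSum_mul, ← h.residueSum_lin_mul hu, ← h.residueSum_lin_mul hv,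
        ← residueSum_mul, ← residueSum_mul, ← residueSum_sub]
      refine residueSum_congr fun i hi => ?_
      have h1 : incl ξ (SymmetricAlgebra.ι ℝ (LinearMap.ker ξ) w) =
          algebraMap ℝ (S n) (ξ (a v)) * lin (a u) - algebraMap ℝ (S n) (ξ (a u)) * lin (a v) := by
        rw [← Algebra.smul_def, ← Algebra.smul_def, lin, lin, ← map_smul, ← map_smul, ← map_sub]
        simp only [incl, SymmetricAlgebra.lift_ι_apply, LinearMap.comp_apply,
          Submodule.subtype_apply, w]
      rw [← along_incl (h.1 i hi) (SymmetricAlgebra.ι ℝ (LinearMap.ker ξ) w), h1]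
      simp only [map_sub, map_mul, AlgHom.commutes, mul_one]
    have hz : residueSum ξ K a (U.erase u) (fun _ => 1) * algebraMap (Sperp ξ) _
          (algebraMap ℝ (Sperp ξ) (ξ (a v))) -
        algebraMap (Sperp ξ) _ (algebraMap ℝ (Sperp ξ) (ξ (a u))) *
          residueSum ξ K a (U.erase v) (fun _ => 1) = 0 := by
      rcases hU.eq_or_lt with h2 | h3
      · have hsing : ∀ {x y : ι}, x ∈ U → y ∈ U → x ≠ y → U.erase x = {y} := by
          intro x y hx hy hxy
          symm
          apply Finset.eq_of_subset_of_card_le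
          · rw [Finset.singleton_subset_iff, Finset.mem_erase]
            exact ⟨hxy.symm, hy⟩
          · rw [Finset.card_erase_of_mem hx, ← h2, Finset.card_singleton]
        rw [hsing hu hv huv, hsing hv hu huv.symm, residueSum_singleton_one (h.1 v hv),
          residueSum_singleton_one (h.1 u hu), ← map_mul, ← map_mul, ← map_mul, ← map_mul,
          inv_mul_cancel₀ (h.1 v hv), mul_inv_cancel₀ (h.1 u hu), sub_self]
      · have hz : ∀ x ∈ U, residueSum ξ K a (U.erase x) (fun _ => 1) = 0 := fun x hx => by
          have hc := Finset.card_erase_of_mem hx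
          exact ih (U.erase x).card (by omega) (h.mono (Finset.erase_subset x U)) (by omega) rfl
        rw [hz u hu, hz v hv, zero_mul, mul_zero, sub_zero]
    rw [mul_comm (residueSum ξ K a (U.erase u) _)] at hz
    rw [hz] at key
    exact (mul_eq_zero.1 key).resolve_left (algebraMap_fractionRing_ne_zero hw)

/-- The residues of a polynomial sum to a polynomial. -/
theorem IsTransverseFamily.residueSum_along_mem (h : IsTransverseFamily ξ a U) (F : S n) :
    residueSum ξ K a U (fun i => along ξ (a i) F) ∈
      (algebraMap (Sperp ξ) K).range := by
  induction U using Finset.induction_on generalizing F with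
  | empty => simp [residueSum]
  | insert u U hu ih =>
    have huU := Finset.mem_insert_self u U
    obtain ⟨G, hG⟩ := lin_dvd_sub_incl_along (h.1 u huU) F
    have h1 : residueSum ξ K a (insert u U) (fun i => along ξ (a i) F) =
        algebraMap (Sperp ξ) _ (along ξ (a u) F) * residueSum ξ K a (insert u U) (fun _ => 1) +
          residueSum ξ K a U (fun i => along ξ (a i) G) := by
      have h2 := h.residueSum_lin_mul (K := K) huU (fun i => along ξ (a i) G)
      rw [Finset.erase_insert hu] at h2
      rw [← h2, ← residueSum_mul, ← residueSum_add]
      refine residueSum_congr fun i hi => ?_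
      rw [← map_mul, ← hG, map_sub, along_incl (h.1 i hi), mul_one, add_sub_cancel]
    rw [h1]
    refine add_mem (mul_mem ⟨_, rfl⟩ ?_) (ih (h.mono (Finset.subset_insert u U)) G)
    rcases U.eq_empty_or_nonempty with rfl | hne
    · rw [insert_empty_eq, residueSum_singleton_one (h.1 u huU)]
      exact ⟨_, rfl⟩
    · rw [h.residueSum_one_eq_zero]
      · exact zero_mem _
      · rw [Finset.card_insert_of_notMem hu]
        have := hne.card_pos
        omega

/-- Prescribed values modulo the linear forms `a i` are taken by a polynomial if their residues
against every polynomial sum to a polynomial. -/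
theorem IsTransverseFamily.exists_along_eq (h : IsTransverseFamily ξ a U) (g : ι → Sperp ξ)
    (hg : ∀ G : S n, residueSum ξ K a U (fun i => g i * along ξ (a i) G) ∈
      (algebraMap (Sperp ξ) K).range) :
    ∃ F : S n, ∀ i ∈ U, along ξ (a i) F = g i := by
  induction U using Finset.induction_on with
  | empty => exact ⟨0, by simp⟩
  | insert u U hu ih =>
    have huU := Finset.mem_insert_self u U
    have hξu := h.1 u huU
    obtain ⟨F, hF⟩ := ih (h.mono (Finset.subset_insert u U)) (fun G => by
      have h1 := h.residueSum_lin_mul (K := K) huU (fun i => g i * along ξ (a i) G)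
      rw [Finset.erase_insert hu] at h1
      rw [← h1]
      convert hg (lin (a u) * G) using 2
      funext i
      rw [map_mul]; ring)
    -- only the residue at `u` is left after subtraction of `F`
    obtain ⟨s, hs⟩ : residueSum ξ K a (insert u U) (fun i => g i - along ξ (a i) F) ∈
        (algebraMap (Sperp ξ) K).range := by
      rw [residueSum_sub]
      refine sub_mem ?_ (h.residueSum_along_mem F)
      simpa using hg 1
    rw [residueSum, Finset.sum_insert hu, Finset.sum_eq_zero (s := U) (fun i hi => by
      rw [hF i hi, sub_self, map_zero, zero_div]), add_zero, eq_div_iff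
      (algebraMap_fractionRing_ne_zero (h.residueDen_ne_zero huU)), ← map_mul] at hs
    replace hs := IsFractionRing.injective (Sperp ξ) K hs
    refine ⟨F + (∏ j ∈ U, lin (a j)) * incl ξ (s * algebraMap ℝ _ (ξ (a u))), fun i hi => ?_⟩
    rcases Finset.mem_insert.1 hi with rfl | hi
    · rw [residueDen, Finset.erase_insert hu] at hs
      rw [map_add, map_mul, along_incl hξu, map_prod, sub_eq_iff_eq_add'.1 hs.symm]
      ring
    · have h0 := along_self (h.1 i (Finset.mem_insert_of_mem hi))
      rw [map_add, map_mul, map_prod, Finset.prod_eq_zero hi h0, zero_mul, add_zero, hF i hi]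

end Residues

variable {n : ℕ} {V : Type*}

/-! ### The numbers of vertices of given index -/

section Betti

theorem apply_α_symm (Γ : OneSkeleton n V) (ξ : (Fin n → ℝ) →ₗ[ℝ] ℝ) {p q : V}
    (h : Γ.graph.Adj p q) : ξ (Γ.α q p) = -ξ (Γ.α p q) := by
  rw [Γ.α_symm q p h.symm, map_neg]

theorem α_notMem_span (Γ : OneSkeleton n V) {p q r : V} (hq : Γ.graph.Adj p q)
    (hr : Γ.graph.Adj p r) (hne : q ≠ r) : Γ.α p r ∉ Submodule.span ℝ {Γ.α p q} := by
  intro h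
  obtain ⟨t, ht⟩ := Submodule.mem_span_singleton.1 h
  have := LinearIndependent.pair_iff.1 (Γ.α_indep p q r hq hr hne) t (-1)
    (by rw [ht, neg_one_smul, add_neg_cancel])
  exact neg_ne_zero.2 one_ne_zero this.2

theorem mem_nbrs [Finite V] (Γ : OneSkeleton n V) {p q : V} : q ∈ Γ.nbrs p ↔ Γ.graph.Adj p q := by
  simp [nbrs]

theorem mem_downNbrs [Finite V] (Γ : OneSkeleton n V) {ξ : (Fin n → ℝ) →ₗ[ℝ] ℝ} {p q : V} :
    q ∈ Γ.downNbrs ξ p ↔ Γ.graph.Adj p q ∧ ξ (Γ.α p q) < 0 := by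
  simp [downNbrs]

variable [Fintype V] (Γ : OneSkeleton n V) {ξ ξ' : (Fin n → ℝ) →ₗ[ℝ] ℝ}

/-- If the orientations induced by `ξ` and `ξ'` differ at `p` and at `q` exactly in the edge `pq`,
then `θ_{pq}` identifies the edges which flow into `p` for `ξ` with those which flow into `q`
for `ξ'`. -/
theorem index_eq_of_wall (hξ : Γ.IsPolarizing ξ) (hξ' : Γ.IsPolarizing ξ')
    (huniq : ∀ p q r, Γ.graph.Adj p q → Γ.graph.Adj p r → ξ (Γ.α p q) * ξ' (Γ.α p q) < 0 →
      ξ (Γ.α p r) * ξ' (Γ.α p r) < 0 → q = r)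
    {p q : V} (hpq : Γ.graph.Adj p q) (hneg : ξ (Γ.α p q) * ξ' (Γ.α p q) < 0) :
    Γ.index ξ p = Γ.index ξ' q := by
  have hsame : ∀ {x y z : V}, Γ.graph.Adj x y → Γ.graph.Adj x z → z ≠ y →
      ξ (Γ.α x y) * ξ' (Γ.α x y) < 0 → 0 < ξ (Γ.α x z) * ξ' (Γ.α x z) := by
    intro x y z hy hz hne h
    rcases lt_trichotomy (ξ (Γ.α x z) * ξ' (Γ.α x z)) 0 with h1 | h1 | h1
    · exact absurd (huniq x z y hz hy h1 h) hne
    · exact absurd h1 (mul_ne_zero (hξ x z hz) (hξ' x z hz))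
    · exact h1
  have hneg' : ξ (Γ.α q p) * ξ' (Γ.α q p) < 0 := by
    rw [Γ.apply_α_symm ξ hpq, Γ.apply_α_symm ξ' hpq, neg_mul_neg]; exact hneg
  have key : ∀ r, Γ.graph.Adj p r → (ξ (Γ.α p r) < 0 ↔ ξ' (Γ.α q (Γ.θ p q r)) < 0) := by
    intro r hr
    by_cases hrq : r = q
    · rw [hrq, Γ.θ_self p q hpq, Γ.apply_α_symm ξ' hpq, neg_lt_zero]
      constructor
      · intro h
        exact pos_of_mul_neg_right hneg h.le
      · intro h
        exact neg_of_mul_neg_left hneg h.le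
    · have hs := Γ.θ_adj p q r hpq hr
      have hsp : Γ.θ p q r ≠ p := by
        intro h
        have h1 := Γ.θ_inv p q r hpq hr
        rw [h, Γ.θ_self q p hpq.symm] at h1
        exact hrq h1.symm
      have hA := hsame hpq hr hrq hneg
      have hB := hsame hpq.symm hs hsp hneg'
      obtain ⟨t, ht⟩ := Γ.α_compat p q r hpq hr
      have hl := Γ.lam_pos p q r hpq hr
      have e1 := congrArg ξ ht
      have e2 := congrArg ξ' ht
      simp only [map_sub, map_smul, smul_eq_mul] at e1 e2
      -- otherwise `t * ξ (α p q)` and `t * ξ' (α p q)` would have the same sign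
      have htt : t ^ 2 * (ξ (Γ.α p q) * ξ' (Γ.α p q)) ≤ 0 :=
        mul_nonpos_of_nonneg_of_nonpos (sq_nonneg t) hneg.le
      constructor
      · intro h
        by_contra h'
        have hA' : ξ' (Γ.α p r) < 0 := neg_of_mul_pos_right hA h.le
        have hB' := lt_of_le_of_ne (not_lt.1 h') (hξ' _ _ hs).symm
        have hB2 := pos_of_mul_pos_left hB hB'.le
        have m1 := mul_pos hl hB2
        have m2 := mul_pos hl hB'
        nlinarith [mul_pos (show 0 < -(t * ξ (Γ.α p q)) by linarith)
          (show 0 < -(t * ξ' (Γ.α p q)) by linarith)]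
      · intro h
        by_contra h'
        have hA1 := lt_of_le_of_ne (not_lt.1 h') (hξ _ _ hr).symm
        have hA2 := pos_of_mul_pos_right hA hA1.le
        have hB2 := neg_of_mul_pos_left hB h.le
        have m1 := mul_neg_of_pos_of_neg hl hB2
        have m2 := mul_neg_of_pos_of_neg hl h
        nlinarith [mul_pos (show 0 < t * ξ (Γ.α p q) by linarith)
          (show 0 < t * ξ' (Γ.α p q) by linarith)]
  have hinv : ∀ s, Γ.graph.Adj q s → Γ.θ p q (Γ.θ q p s) = s :=
    fun s hs => Γ.θ_inv q p s hpq.symm hs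
  refine Finset.card_nbij' (Γ.θ p q) (Γ.θ q p) ?_ ?_ ?_ ?_
  · intro r hr
    rw [Finset.mem_coe, mem_downNbrs] at hr ⊢
    exact ⟨Γ.θ_adj p q r hpq hr.1, (key r hr.1).1 hr.2⟩
  · intro s hs
    rw [Finset.mem_coe, mem_downNbrs] at hs ⊢
    have h := Γ.θ_adj q p s hpq.symm hs.1
    exact ⟨h, (key _ h).2 (by rw [hinv s hs.1]; exact hs.2)⟩
  · intro r hr
    rw [Finset.mem_coe, mem_downNbrs] at hr
    exact Γ.θ_inv p q r hpq hr.1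
  · intro s hs
    rw [Finset.mem_coe, mem_downNbrs] at hs
    exact hinv s hs.1

theorem sum_index_eq_of_wall (hξ : Γ.IsPolarizing ξ) (hξ' : Γ.IsPolarizing ξ')
    (huniq : ∀ p q r, Γ.graph.Adj p q → Γ.graph.Adj p r → ξ (Γ.α p q) * ξ' (Γ.α p q) < 0 →
      ξ (Γ.α p r) * ξ' (Γ.α p r) < 0 → q = r) (F : ℕ → ℕ) :
    ∑ p, F (Γ.index ξ p) = ∑ p, F (Γ.index ξ' p) := by
  classical
  -- exchange the endpoints of the edges whose orientation changes
  let σ : V → V := fun p =>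
    if h : ∃ q, Γ.graph.Adj p q ∧ ξ (Γ.α p q) * ξ' (Γ.α p q) < 0 then h.choose else p
  have hσ : ∀ {p q}, Γ.graph.Adj p q → ξ (Γ.α p q) * ξ' (Γ.α p q) < 0 → σ p = q := by
    intro p q h1 h2
    have h : ∃ q, Γ.graph.Adj p q ∧ ξ (Γ.α p q) * ξ' (Γ.α p q) < 0 := ⟨q, h1, h2⟩
    simp only [σ, dif_pos h]
    exact huniq p _ q h.choose_spec.1 h1 h.choose_spec.2 h2
  have hσ' : ∀ {p}, (¬ ∃ q, Γ.graph.Adj p q ∧ ξ (Γ.α p q) * ξ' (Γ.α p q) < 0) → σ p = p := by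
    intro p h
    simp only [σ, dif_neg h]
  have hinv : Function.Involutive σ := by
    intro p
    by_cases h : ∃ q, Γ.graph.Adj p q ∧ ξ (Γ.α p q) * ξ' (Γ.α p q) < 0
    · obtain ⟨q, h1, h2⟩ := h
      rw [hσ h1 h2]
      apply hσ h1.symm
      rw [Γ.apply_α_symm ξ h1, Γ.apply_α_symm ξ' h1, neg_mul_neg]
      exact h2
    · rw [hσ' h, hσ' h]
  rw [← Equiv.sum_comp hinv.toPerm fun p => F (Γ.index ξ' p)]
  refine Finset.sum_congr rfl fun p _ => congrArg F ?_
  change Γ.index ξ p = Γ.index ξ' (σ p)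
  by_cases h : ∃ q, Γ.graph.Adj p q ∧ ξ (Γ.α p q) * ξ' (Γ.α p q) < 0
  · obtain ⟨q, h1, h2⟩ := h
    rw [hσ h1 h2]
    exact Γ.index_eq_of_wall hξ hξ' huniq h1 h2
  · rw [hσ' h, index, index]
    congr 1
    ext q
    rw [mem_downNbrs, mem_downNbrs]
    refine and_congr_right fun hq => ?_
    have h1 : 0 < ξ (Γ.α p q) * ξ' (Γ.α p q) := by
      refine lt_of_le_of_ne (not_lt.1 fun h2 => h ⟨q, hq, h2⟩)
        (mul_ne_zero (hξ p q hq) (hξ' p q hq)).symm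
    exact ⟨fun h => neg_of_mul_pos_right h1 h.le, fun h => neg_of_mul_pos_left h1 h.le⟩

/-- If `x` and `y` have opposite signs, then the segment from `x` to `y` crosses zero at the
parameter `x / (x - y)`. -/
theorem crossing_parameter {x y : ℝ} (h : x * y < 0) :
    0 < x / (x - y) ∧ x / (x - y) < 1 ∧ ∀ t, (t < x / (x - y) → 0 < x * ((1 - t) * x + t * y)) ∧
      (x / (x - y) < t → 0 < ((1 - t) * x + t * y) * y) := by
  rcases mul_neg_iff.1 h with ⟨hx, hy⟩ | ⟨hx, hy⟩
  · have hd : 0 < x - y := by linarith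
    refine ⟨div_pos hx hd, by rw [div_lt_one hd]; linarith, fun t => ⟨fun ht => ?_, fun ht => ?_⟩⟩
    · rw [lt_div_iff₀ hd] at ht
      exact mul_pos hx (by linarith)
    · rw [div_lt_iff₀ hd] at ht
      exact mul_pos_of_neg_of_neg (by linarith) hy
  · have hd : x - y < 0 := by linarith
    refine ⟨div_pos_of_neg_of_neg hx hd, by rw [div_lt_one_of_neg hd]; linarith,
      fun t => ⟨fun ht => ?_, fun ht => ?_⟩⟩
    · rw [lt_div_iff_of_neg hd] at ht
      exact mul_pos_of_neg_of_neg hx (by linarith)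
    · rw [div_lt_iff_of_neg hd] at ht
      exact mul_pos (by linarith) hy

/-- The Betti numbers agree for covectors `ξ`, `ξ'` whose restrictions to the span of any two edges
at a vertex are not proportional: along the segment from `ξ` to `ξ'`, two edges at the same vertex
never change their orientation simultaneously, and the segment is cut until one wall is left. -/
theorem sum_index_eq_of_cross (hξ : Γ.IsPolarizing ξ) (hξ' : Γ.IsPolarizing ξ')
    (hcross : ∀ p q r, Γ.graph.Adj p q → Γ.graph.Adj p r → q ≠ r →
      ξ (Γ.α p q) * ξ' (Γ.α p r) - ξ (Γ.α p r) * ξ' (Γ.α p q) ≠ 0) (F : ℕ → ℕ) :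
    ∑ p, F (Γ.index ξ p) = ∑ p, F (Γ.index ξ' p) := by
  classical
  let D : ((Fin n → ℝ) →ₗ[ℝ] ℝ) → ((Fin n → ℝ) →ₗ[ℝ] ℝ) → Finset (V × V) := fun ξ ξ' =>
    Finset.univ.filter fun e => Γ.graph.Adj e.1 e.2 ∧ ξ (Γ.α e.1 e.2) * ξ' (Γ.α e.1 e.2) < 0
  have hD : ∀ {ξ ξ' e}, e ∈ D ξ ξ' ↔
      Γ.graph.Adj e.1 e.2 ∧ ξ (Γ.α e.1 e.2) * ξ' (Γ.α e.1 e.2) < 0 := by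
    intro ξ ξ' e; simp [D]
  induction hN : (D ξ ξ').card using Nat.strong_induction_on generalizing ξ ξ' with
  | _ N ih =>
    by_cases huniq : ∀ p q r, Γ.graph.Adj p q → Γ.graph.Adj p r →
        ξ (Γ.α p q) * ξ' (Γ.α p q) < 0 → ξ (Γ.α p r) * ξ' (Γ.α p r) < 0 → q = r
    · exact Γ.sum_index_eq_of_wall hξ hξ' huniq F
    · push Not at huniq
      -- the parameter at which the segment crosses the wall of an edge
      let T : V × V → ℝ := fun e =>
        ξ (Γ.α e.1 e.2) / (ξ (Γ.α e.1 e.2) - ξ' (Γ.α e.1 e.2))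
      have hsub : ∀ {x y : ℝ}, x * y < 0 → x - y ≠ 0 := by
        intro x y h h0
        rw [sub_eq_zero.1 h0] at h
        exact absurd h (not_lt.2 (mul_self_nonneg y))
      obtain ⟨p, q, r, hq, hr, hqn, hrn, hT⟩ : ∃ p q r, Γ.graph.Adj p q ∧ Γ.graph.Adj p r ∧
          ξ (Γ.α p q) * ξ' (Γ.α p q) < 0 ∧ ξ (Γ.α p r) * ξ' (Γ.α p r) < 0 ∧
          T (p, q) < T (p, r) := by
        obtain ⟨p, q, r, hq, hr, hqn, hrn, hne⟩ := huniq
        have : T (p, q) ≠ T (p, r) := by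
          intro h
          have h' : ξ (Γ.α p q) / (ξ (Γ.α p q) - ξ' (Γ.α p q)) =
            ξ (Γ.α p r) / (ξ (Γ.α p r) - ξ' (Γ.α p r)) := h
          rw [div_eq_div_iff (hsub hqn) (hsub hrn)] at h'
          apply hcross p q r hq hr hne
          linarith
        rcases this.lt_or_gt with h | h
        · exact ⟨p, q, r, hq, hr, hqn, hrn, h⟩
        · exact ⟨p, r, q, hr, hq, hrn, hqn, h⟩
      obtain ⟨t, ht, htn⟩ := (Set.Ioo_infinite hT).exists_notMem_finite (Set.finite_range T)
      have hcq := crossing_parameter hqn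
      have hcr := crossing_parameter hrn
      have ht0 : 0 < t := hcq.1.trans ht.1
      have ht1 : t < 1 := ht.2.trans hcr.2.1
      let ζ : (Fin n → ℝ) →ₗ[ℝ] ℝ := (1 - t) • ξ + t • ξ'
      have hζ : ∀ v, ζ v = (1 - t) * ξ v + t * ξ' v := fun v => by simp [ζ]
      have hζpol : Γ.IsPolarizing ζ := by
        intro x y hxy h0
        rw [hζ] at h0
        have h1 : t * (ξ (Γ.α x y) - ξ' (Γ.α x y)) = ξ (Γ.α x y) := by linarith
        refine htn ⟨(x, y), ?_⟩
        change ξ (Γ.α x y) / (ξ (Γ.α x y) - ξ' (Γ.α x y)) = t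
        rw [div_eq_iff, h1]
        intro h2
        rw [h2, mul_zero] at h1
        exact hξ x y hxy h1.symm
      have hlt1 : (D ξ ζ).card < (D ξ ξ').card := by
        apply Finset.card_lt_card
        refine ⟨fun e he => ?_, fun h => ?_⟩
        · rw [hD] at he ⊢
          refine ⟨he.1, ?_⟩
          have h2 := he.2
          rw [hζ] at h2
          have := mul_nonneg (sub_nonneg.2 ht1.le) (mul_self_nonneg (ξ (Γ.α e.1 e.2)))
          by_contra h3
          have := mul_nonneg ht0.le (not_lt.1 h3)
          nlinarith
        · have h1 := (hD.1 (h (hD.2 ⟨hr, hrn⟩ : (p, r) ∈ D ξ ξ'))).2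
          rw [hζ] at h1
          exact lt_asymm h1 ((hcr.2.2 t).1 ht.2)
      have hlt2 : (D ζ ξ').card < (D ξ ξ').card := by
        apply Finset.card_lt_card
        refine ⟨fun e he => ?_, fun h => ?_⟩
        · rw [hD] at he ⊢
          refine ⟨he.1, ?_⟩
          have h2 := he.2
          rw [hζ] at h2
          have := mul_nonneg ht0.le (mul_self_nonneg (ξ' (Γ.α e.1 e.2)))
          by_contra h3
          have := mul_nonneg (sub_nonneg.2 ht1.le) (not_lt.1 h3)
          nlinarith
        · have h1 := (hD.1 (h (hD.2 ⟨hq, hqn⟩ : (p, q) ∈ D ξ ξ'))).2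
          rw [hζ] at h1
          exact lt_asymm h1 ((hcq.2.2 t).2 ht.1)
      rw [ih _ (hN ▸ hlt1) hξ hζpol ?_ rfl, ih _ (hN ▸ hlt2) hζpol hξ' ?_ rfl]
      · intro x y z hy hz hyz
        rw [hζ, hζ]
        convert mul_ne_zero (sub_ne_zero.2 ht1.ne') (hcross x y z hy hz hyz) using 1
        ring
      · intro x y z hy hz hyz
        rw [hζ, hζ]
        convert mul_ne_zero ht0.ne' (hcross x y z hy hz hyz) using 1
        ring

/-- The number of vertices of each index does not depend on the polarizing covector. -/
theorem sum_index_eq (hξ : Γ.IsPolarizing ξ) (hξ' : Γ.IsPolarizing ξ') (F : ℕ → ℕ) :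
    ∑ p, F (Γ.index ξ p) = ∑ p, F (Γ.index ξ' p) := by
  -- an intermediate covector in general position with respect to both
  let w : ((Fin n → ℝ) →ₗ[ℝ] ℝ) → V × V × V → (Fin n → ℝ) := fun ξ x =>
    ξ (Γ.α x.1 x.2.1) • Γ.α x.1 x.2.2 - ξ (Γ.α x.1 x.2.2) • Γ.α x.1 x.2.1
  let A : Set (Fin n → ℝ) :=
    Set.range (fun e : V × V => Γ.α e.1 e.2) ∪ (Set.range (w ξ) ∪ Set.range (w ξ'))
  have hA : A.Finite :=
    (Set.finite_range _).union ((Set.finite_range _).union (Set.finite_range _))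
  have : Finite {v // v ∈ A ∧ v ≠ 0} := (hA.subset fun v hv => hv.1).to_subtype
  obtain ⟨ζ, hζ⟩ := Module.exists_dual_forall_apply_ne_zero (K := ℝ)
    (fun v : {v // v ∈ A ∧ v ≠ 0} => (v : Fin n → ℝ)) fun v => v.2.2
  have hζA : ∀ v ∈ A, v ≠ 0 → ζ v ≠ 0 := fun v h1 h2 => hζ ⟨v, h1, h2⟩
  have hw : ∀ {η : (Fin n → ℝ) →ₗ[ℝ] ℝ}, Γ.IsPolarizing η → ∀ {p q r}, Γ.graph.Adj p q →
      Γ.graph.Adj p r → q ≠ r → w η (p, q, r) ≠ 0 := by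
    intro η hη p q r hq hr hne h0
    have h1 : η (Γ.α p q) • Γ.α p r = η (Γ.α p r) • Γ.α p q := sub_eq_zero.1 h0
    refine Γ.α_notMem_span hq hr hne (Submodule.mem_span_singleton.2
      ⟨(η (Γ.α p q))⁻¹ * η (Γ.α p r), ?_⟩)
    rw [mul_smul, ← h1, smul_smul, inv_mul_cancel₀ (hη p q hq), one_smul]
  have hζpol : Γ.IsPolarizing ζ := fun p q hpq =>
    hζA _ (Or.inl ⟨(p, q), rfl⟩) (ne_zero_of_apply_ne_zero (hξ p q hpq))
  have hw' : ∀ (η : (Fin n → ℝ) →ₗ[ℝ] ℝ) p q r, ζ (w η (p, q, r)) =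
      η (Γ.α p q) * ζ (Γ.α p r) - η (Γ.α p r) * ζ (Γ.α p q) := by
    intro η p q r
    simp [w]
  rw [Γ.sum_index_eq_of_cross hξ hζpol ?_ F, ← Γ.sum_index_eq_of_cross hξ' hζpol ?_ F]
  · intro p q r hq hr hne
    rw [← hw']
    exact hζA _ (Or.inr (Or.inr ⟨_, rfl⟩)) (hw hξ' hq hr hne)
  · intro p q r hq hr hne
    rw [← hw']
    exact hζA _ (Or.inr (Or.inl ⟨_, rfl⟩)) (hw hξ hq hr hne)

end Betti

/-! ### The degree filtration -/

section Degree

variable {n : ℕ}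

/-- `S` as a polynomial ring in the coordinates. -/
def toPoly (n : ℕ) : S n ≃ₐ[ℝ] MvPolynomial (Fin n) ℝ :=
  SymmetricAlgebra.equivMvPolynomial (Pi.basisFun ℝ (Fin n))

/-- The elements of `S` of degree at most `k - m`, and only zero if `k < m`; so these are the `s`
such that `D * s` has degree at most `k`, for any `D ≠ 0` of degree `m`. -/
def degreeLE (n k m : ℕ) : Submodule ℝ (S n) where
  carrier := {s | s = 0 ∨ (toPoly n s).totalDegree + m ≤ k}
  zero_mem' := Or.inl rfl
  add_mem' := by
    rintro x y (rfl | hx) (rfl | hy)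
    · left; rw [add_zero]
    · right; rwa [zero_add]
    · right; rwa [add_zero]
    · right
      have := MvPolynomial.totalDegree_add (toPoly n x) (toPoly n y)
      rw [← map_add] at this
      omega
  smul_mem' := by
    rintro t x (rfl | hx)
    · left; rw [smul_zero]
    · right
      have := MvPolynomial.totalDegree_smul_le t (toPoly n x)
      rw [← map_smul] at this
      omega

theorem mem_degreeLE {k m : ℕ} {s : S n} :
    s ∈ degreeLE n k m ↔ s = 0 ∨ (toPoly n s).totalDegree + m ≤ k := Iff.rfl

theorem mem_degreeLE_zero {k : ℕ} {s : S n} :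
    s ∈ degreeLE n k 0 ↔ (toPoly n s).totalDegree ≤ k := by
  rw [mem_degreeLE, add_zero]
  refine ⟨?_, Or.inr⟩
  rintro (rfl | h)
  · simp
  · exact h

theorem degreeLE_le (k m : ℕ) : degreeLE n k m ≤ degreeLE n k 0 := by
  rintro s (rfl | h)
  · exact zero_mem _
  · rw [mem_degreeLE_zero]; omega

instance (k : ℕ) : Module.Finite ℝ (degreeLE n k 0) := by
  let g : degreeLE n k 0 →ₗ[ℝ] MvPolynomial.restrictTotalDegree (Fin n) ℝ k :=
    LinearMap.codRestrict _ ((toPoly n).toLinearMap ∘ₗ (degreeLE n k 0).subtype) fun s => by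
      rw [MvPolynomial.mem_restrictTotalDegree]
      exact mem_degreeLE_zero.1 s.2
  refine Module.Finite.of_injective g fun s t h => ?_
  exact Subtype.ext ((toPoly n).injective (congrArg Subtype.val h))

instance (k m : ℕ) : Module.Finite ℝ (degreeLE n k m) :=
  Module.Finite.of_injective (Submodule.inclusion (degreeLE_le k m))
    (Submodule.inclusion_injective _)

theorem mul_mem_degreeLE {k m : ℕ} {s t : S n} (hs : s ∈ degreeLE n k m)
    (ht : t ∈ degreeLE n m 0) : s * t ∈ degreeLE n k 0 := by
  rw [mem_degreeLE_zero] at ht ⊢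
  rcases hs with rfl | hs
  · simp
  · rw [map_mul]
    have := MvPolynomial.totalDegree_mul (toPoly n s) (toPoly n t)
    omega

theorem mem_degreeLE_of_mul_mem {k m : ℕ} {D s : S n} (hD : D ≠ 0)
    (hm : (toPoly n D).totalDegree = m) (h : D * s ∈ degreeLE n k 0) : s ∈ degreeLE n k m := by
  rw [mem_degreeLE_zero, map_mul] at h
  rw [mem_degreeLE, or_iff_not_imp_left]
  intro hs
  rw [MvPolynomial.totalDegree_mul_of_isDomain
    ((map_ne_zero_iff _ (toPoly n).injective).2 hD)
    ((map_ne_zero_iff _ (toPoly n).injective).2 hs), hm] at h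
  omega

theorem totalDegree_toPoly_lin_le (v : Fin n → ℝ) : (toPoly n (lin v)).totalDegree ≤ 1 := by
  have h : toPoly n (lin v) = ∑ i, v i • (MvPolynomial.X i : MvPolynomial (Fin n) ℝ) := by
    conv_lhs => rw [← (Pi.basisFun ℝ (Fin n)).sum_repr v]
    simp only [lin, map_sum, map_smul, toPoly, SymmetricAlgebra.equivMvPolynomial_ι_apply,
      Pi.basisFun_repr]
  rw [h]
  refine MvPolynomial.totalDegree_finsetSum_le fun i _ => ?_
  exact (MvPolynomial.totalDegree_smul_le _ _).trans (MvPolynomial.totalDegree_X i).le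

theorem totalDegree_toPoly_lin {v : Fin n → ℝ} (hv : v ≠ 0) :
    (toPoly n (lin v)).totalDegree = 1 := by
  refine le_antisymm (totalDegree_toPoly_lin_le v) (Nat.one_le_iff_ne_zero.2 fun h0 => ?_)
  have hp := prime_ι hv
  rw [← MulEquiv.prime_iff (toPoly n).toMulEquiv] at hp
  rw [MvPolynomial.totalDegree_eq_zero_iff_eq_C] at h0
  have h1 : (toPoly n).toMulEquiv (SymmetricAlgebra.ι ℝ (Fin n → ℝ) v) = toPoly n (lin v) := rfl
  rw [h1, h0] at hp
  have hc : (toPoly n (lin v)).coeff 0 ≠ 0 := by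
    intro hc
    rw [hc, map_zero] at hp
    exact hp.ne_zero rfl
  exact hp.not_isUnit ((isUnit_iff_ne_zero.2 hc).map MvPolynomial.C)

theorem totalDegree_toPoly_prod_lin {ι : Type*} (T : Finset ι) {a : ι → Fin n → ℝ}
    (h : ∀ i ∈ T, a i ≠ 0) : (toPoly n (∏ i ∈ T, lin (a i))).totalDegree = T.card := by
  classical
  induction T using Finset.induction_on with
  | empty => simp
  | insert i T hi ih =>
    have h1 := h i (Finset.mem_insert_self i T)
    have h2 := fun j hj => h j (Finset.mem_insert_of_mem hj)
    rw [Finset.prod_insert hi, map_mul, MvPolynomial.totalDegree_mul_of_isDomain,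
      totalDegree_toPoly_lin h1, ih h2, Finset.card_insert_of_notMem hi, add_comm]
    · exact (map_ne_zero_iff _ (toPoly n).injective).2 (prime_ι h1).ne_zero
    · exact (map_ne_zero_iff _ (toPoly n).injective).2
        (Finset.prod_ne_zero_iff.2 fun j hj => (prime_ι (h2 j hj)).ne_zero)

theorem homogeneousPart_le_degreeLE (k : ℕ) : homogeneousPart n k ≤ degreeLE n k 0 := by
  induction k with
  | zero =>
    rw [homogeneousPart, pow_zero, Submodule.one_le, mem_degreeLE_zero]
    simp
  | succ k ih =>
    rw [homogeneousPart, pow_succ, Submodule.mul_le]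
    rintro s hs _ ⟨v, rfl⟩
    have h1 := mem_degreeLE_zero.1 (ih hs)
    have h2 := totalDegree_toPoly_lin_le v
    rw [mem_degreeLE_zero, map_mul]
    have h3 := MvPolynomial.totalDegree_mul (toPoly n s) (toPoly n (lin v))
    change (toPoly n s * toPoly n (lin v)).totalDegree ≤ k + 1
    omega

end Degree

/-! ### Generating families for every polarizing covector -/

section Flag

variable {V E : Type*} [AddCommGroup E] [Module ℝ E]

/-- The functions in `X` that vanish on `U`. -/
def vanishingOn (X : Submodule ℝ (V → E)) (U : Set V) : Submodule ℝ (V → E) where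
  carrier := {f | f ∈ X ∧ ∀ u ∈ U, f u = 0}
  zero_mem' := ⟨zero_mem _, fun _ _ => rfl⟩
  add_mem' hf hg := ⟨add_mem hf.1 hg.1, fun u hu => by
    rw [Pi.add_apply, hf.2 u hu, hg.2 u hu, add_zero]⟩
  smul_mem' t f hf := ⟨Submodule.smul_mem _ t hf.1, fun u hu => by
    rw [Pi.smul_apply, hf.2 u hu, smul_zero]⟩

/-- The values at `p` of the functions in `X` that vanish at the vertices below `p`. -/
def leadingValues (X : Submodule ℝ (V → E)) (φ : V → ℝ) (p : V) : Submodule ℝ E :=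
  (vanishingOn X {v | φ v < φ p}).map (LinearMap.proj p)

/-- The dimension of a space of functions is bounded by the dimensions of the leading values. -/
theorem finrank_le_sum_leadingValues [Fintype V] (X : Submodule ℝ (V → E)) [Module.Finite ℝ X]
    {φ : V → ℝ} (hφ : Function.Injective φ) :
    Module.finrank ℝ X ≤ ∑ p, Module.finrank ℝ (leadingValues X φ p) := by
  classical
  have hfin : ∀ U : Set V, Module.Finite ℝ (vanishingOn X U) := fun U =>
    Module.Finite.of_injective (Submodule.inclusion (fun f (hf : f ∈ vanishingOn X U) => hf.1))
      (Submodule.inclusion_injective _)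
  have key : ∀ U : Finset V, (∀ u ∈ U, ∀ v, φ v < φ u → v ∈ U) → Module.finrank ℝ X ≤
      ∑ p ∈ U, Module.finrank ℝ (leadingValues X φ p) +
        Module.finrank ℝ (vanishingOn X (U : Set V)) := by
    intro U
    induction U using Finset.induction_on_max_value φ with
    | empty =>
      intro _
      have : vanishingOn X ((∅ : Finset V) : Set V) = X :=
        le_antisymm (fun f hf => hf.1) fun f hf => ⟨hf, by simp⟩
      rw [this, Finset.sum_empty, zero_add]
    | insert a s ha hmax ih =>
      intro hU
      have hs : ∀ u ∈ s, ∀ v, φ v < φ u → v ∈ s := fun u hu v hv =>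
        Finset.mem_of_mem_insert_of_ne (hU u (Finset.mem_insert_of_mem hu) v hv)
          fun h => absurd (hmax u hu) (not_le.2 (h ▸ hv))
      have hsa : (s : Set V) = {v | φ v < φ a} := by
        ext v
        constructor
        · intro hv
          exact lt_of_le_of_ne (hmax v hv) fun h => ha (hφ h ▸ hv)
        · intro hv
          exact Finset.mem_of_mem_insert_of_ne (hU a (Finset.mem_insert_self a s) v hv)
            fun h => absurd hv (by simp [h])
      let g : vanishingOn X (s : Set V) →ₗ[ℝ] E :=
        (LinearMap.proj a).domRestrict (vanishingOn X (s : Set V))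
      have hr : LinearMap.range g = leadingValues X φ a := by
        rw [leadingValues, ← hsa, LinearMap.range_domRestrict]
      have hk : (LinearMap.ker g).map (vanishingOn X (s : Set V)).subtype =
          vanishingOn X ((insert a s : Finset V) : Set V) := by
        ext f
        constructor
        · rintro ⟨f, hf, rfl⟩
          refine ⟨f.2.1, fun u hu => ?_⟩
          rcases Finset.mem_insert.1 (Finset.mem_coe.1 hu) with rfl | hu
          · exact hf
          · exact f.2.2 u hu
        · intro hf
          exact ⟨⟨f, hf.1, fun u hu => hf.2 u (Finset.mem_insert_of_mem hu)⟩,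
            hf.2 a (Finset.mem_insert_self a s), rfl⟩
      have := hfin (s : Set V)
      have h1 := LinearMap.finrank_range_add_finrank_ker g
      have h2 := Submodule.finrank_map_subtype_eq (vanishingOn X (s : Set V)) (LinearMap.ker g)
      rw [hk] at h2
      rw [hr, ← h2] at h1
      rw [Finset.sum_insert ha]
      have := ih hs
      omega
  have h := key Finset.univ fun u _ v _ => Finset.mem_univ v
  have h0 : vanishingOn X ((Finset.univ : Finset V) : Set V) = ⊥ := by
    rw [eq_bot_iff]
    intro f hf
    exact (Submodule.mem_bot ℝ).2 (funext fun v => hf.2 v (by simp))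
  rwa [h0, finrank_bot, add_zero] at h

end Flag

section Family

variable {n : ℕ} {V : Type*}

/-- A triangular family is linearly independent. -/
theorem eq_zero_of_triangular {R : Type*} [CommRing R] [IsDomain R] [Fintype V]
    {r : V → V → Prop} (hr : WellFounded r) {τ : V → V → R} (hτ : ∀ p, τ p p ≠ 0)
    (hsupp : ∀ p x, τ p x ≠ 0 → p = x ∨ r p x) {s : V → R} (h : ∑ p, s p • τ p = 0) (x : V) :
    s x = 0 := by
  classical
  induction x using hr.induction with
  | _ x ih =>
    have h1 := congrFun h x
    rw [Finset.sum_apply, Finset.sum_eq_single x] at h1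
    · exact (mul_eq_zero.1 h1).resolve_right (hτ x)
    · intro p _ hpx
      by_cases h2 : τ p x = 0
      · rw [Pi.smul_apply, h2, smul_zero]
      · rw [Pi.smul_apply, ih p ((hsupp p x h2).resolve_left hpx), zero_smul]
    · intro hx
      exact absurd (Finset.mem_univ x) hx

/-- The product of the edges that flow into `p`. -/
def downProd [Finite V] (Γ : OneSkeleton n V) (ξ : (Fin n → ℝ) →ₗ[ℝ] ℝ) (p : V) : S n :=
  ∏ q ∈ Γ.downNbrs ξ p, lin (Γ.α p q)

/-- A class that vanishes below `p` with respect to `φ`, and whose value at `p` is the product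
of the edges that flow into `p`.  Homogeneity, and the support condition of a generating class, are
not required. -/
structure IsLeadingClass [Finite V] (Γ : OneSkeleton n V) (ξ : (Fin n → ℝ) →ₗ[ℝ] ℝ) (φ : V → ℝ)
    (p : V) (f : V → S n) : Prop where
  mem : f ∈ Γ.cohomology
  eq_zero : ∀ v, φ v < φ p → f v = 0
  self : f p = Γ.downProd ξ p

variable {Γ : OneSkeleton n V} {ξ : (Fin n → ℝ) →ₗ[ℝ] ℝ} {φ : V → ℝ}

theorem IsMorseFunction.lt_iff (hφ : Γ.IsMorseFunction ξ φ) (hξ : Γ.IsPolarizing ξ) {p q : V}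
    (h : Γ.graph.Adj p q) : φ q < φ p ↔ ξ (Γ.α p q) < 0 := by
  constructor
  · intro hlt
    rcases lt_trichotomy (ξ (Γ.α p q)) 0 with h1 | h1 | h1
    · exact h1
    · exact absurd h1 (hξ p q h)
    · exact absurd (hφ.increasing p q ⟨h, h1⟩) hlt.not_gt
  · intro hlt
    refine hφ.increasing q p ⟨h.symm, ?_⟩
    rw [Γ.apply_α_symm ξ h]
    exact neg_pos.2 hlt

theorem lin_dvd_sub_of_mem {f : V → S n} (hf : f ∈ Γ.cohomology) {p q : V}
    (h : Γ.graph.Adj p q) : lin (Γ.α p q) ∣ f q - f p :=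
  Ideal.mem_span_singleton.1 (hf p q h)

variable [Finite V]

theorem IsMorseFunction.mem_downNbrs_iff (hφ : Γ.IsMorseFunction ξ φ) (hξ : Γ.IsPolarizing ξ)
    {p q : V} : q ∈ Γ.downNbrs ξ p ↔ Γ.graph.Adj p q ∧ φ q < φ p := by
  rw [mem_downNbrs]
  exact and_congr_right fun h => (hφ.lt_iff hξ h).symm

theorem downProd_ne_zero (hξ : Γ.IsPolarizing ξ) (p : V) : Γ.downProd ξ p ≠ 0 :=
  Finset.prod_ne_zero_iff.2 fun _ hq =>
    (prime_ι (ne_zero_of_apply_ne_zero (hξ _ _ (Γ.mem_downNbrs.1 hq).1))).ne_zero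

theorem downProd_dvd (hξ : Γ.IsPolarizing ξ) {p : V} {s : S n}
    (h : ∀ q ∈ Γ.downNbrs ξ p, lin (Γ.α p q) ∣ s) : Γ.downProd ξ p ∣ s :=
  prod_lin_dvd (fun _ hq => ne_zero_of_apply_ne_zero (hξ _ _ (Γ.mem_downNbrs.1 hq).1))
    (fun _ hq _ hr hqr => Γ.α_notMem_span (Γ.mem_downNbrs.1 hq).1 (Γ.mem_downNbrs.1 hr).1 hqr) h

/-- If one polarizing covector has a generating family, then every acyclic polarizing covector has
leading classes at all vertices.  In each degree, the generating family bounds the dimension of the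
cohomology from below, and the leading values with respect to the other covector bound it from
above; as the indices of the two covectors agree up to a permutation of the vertices, all
these bounds are attained. -/
theorem HasMorsePackage.exists_isLeadingClass (hΓ : Γ.HasMorsePackage) (hξ : Γ.IsPolarizing ξ)
    (hφ : Γ.IsMorseFunction ξ φ) (p : V) : ∃ f, Γ.IsLeadingClass ξ φ p f := by
  classical
  have := Fintype.ofFinite V
  obtain ⟨ξ', hξ', τ, hτ⟩ := hΓ
  let k := Γ.index ξ p
  let X : Submodule ℝ (V → S n) :=
    (Γ.cohomology.toSubmodule.restrictScalars ℝ) ⊓ Submodule.pi Set.univ fun _ => degreeLE n k 0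
  have hX : ∀ {f}, f ∈ X ↔ f ∈ Γ.cohomology ∧ ∀ v, f v ∈ degreeLE n k 0 := by
    intro f
    simp [X, Submodule.mem_inf, Submodule.mem_pi]
  have hXfin : Module.Finite ℝ X := by
    let g : X →ₗ[ℝ] (V → degreeLE n k 0) := LinearMap.pi fun v =>
      LinearMap.codRestrict _ (LinearMap.proj v ∘ₗ X.subtype) fun f => (hX.1 f.2).2 v
    refine Module.Finite.of_injective g fun f f' h => Subtype.ext (funext fun v => ?_)
    exact congrArg Subtype.val (congrFun h v)
  -- the lower bound
  have hlow : ∑ q, Module.finrank ℝ (degreeLE n k (Γ.index ξ' q)) ≤ Module.finrank ℝ X := by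
    let g : (∀ q, degreeLE n k (Γ.index ξ' q)) →ₗ[ℝ] X :=
      LinearMap.codRestrict X
        { toFun := fun s => ∑ q, (s q : S n) • τ q
          map_add' := fun s t => by
            simp only [Pi.add_apply, Submodule.coe_add, add_smul, Finset.sum_add_distrib]
          map_smul' := fun t s => by
            simp only [Pi.smul_apply, Submodule.coe_smul, smul_assoc, Finset.smul_sum,
              RingHom.id_apply] }
        (fun s => by
          rw [hX]
          refine ⟨Subalgebra.sum_mem _ fun q _ => Subalgebra.smul_mem _ (hτ q).mem _, fun v => ?_⟩
          change (∑ q, (s q : S n) • τ q) v ∈ _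
          rw [Finset.sum_apply]
          refine Submodule.sum_mem _ fun q _ => ?_
          exact mul_mem_degreeLE (s q).2 (homogeneousPart_le_degreeLE _ ((hτ q).homogeneous v)))
    have hg : Function.Injective g := by
      rw [← LinearMap.ker_eq_bot, eq_bot_iff]
      intro s hs
      have hwf : WellFounded (Relation.TransGen (Γ.Ascends ξ')) := by
        have : Std.Irrefl (Relation.TransGen (Γ.Ascends ξ')) := ⟨hξ'.acyclic⟩
        exact Finite.wellFounded_of_trans_of_irrefl _
      have h0 : ∑ q, (s q : S n) • τ q = 0 := congrArg Subtype.val hs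
      refine (Submodule.mem_bot ℝ).2 (funext fun q => Subtype.ext ?_)
      refine eq_zero_of_triangular hwf (fun q => ?_) (fun q x hx => ?_) h0 q
      · rw [(hτ q).self]
        exact downProd_ne_zero hξ'.polarizing q
      · rcases Relation.reflTransGen_iff_eq_or_transGen.1 ((hτ q).support x hx) with h | h
        · exact Or.inl h.symm
        · exact Or.inr h
    have := LinearMap.finrank_le_finrank_of_injective hg
    rwa [Module.finrank_pi_fintype] at this
  -- the upper bound
  have hle : ∀ q, leadingValues X φ q ≤
      (degreeLE n k (Γ.index ξ q)).map (LinearMap.mulLeft ℝ (Γ.downProd ξ q)) := by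
    rintro q _ ⟨f, ⟨hf, hf0⟩, rfl⟩
    rw [hX] at hf
    obtain ⟨s, hs⟩ : Γ.downProd ξ q ∣ f q := by
      refine downProd_dvd hξ fun r hr => ?_
      obtain ⟨hqr, hlt⟩ := (hφ.mem_downNbrs_iff hξ).1 hr
      have := lin_dvd_sub_of_mem hf.1 hqr
      rwa [hf0 r hlt, zero_sub, dvd_neg] at this
    refine ⟨s, ?_, hs.symm⟩
    refine mem_degreeLE_of_mul_mem (downProd_ne_zero hξ q) ?_ (hs ▸ hf.2 q)
    exact totalDegree_toPoly_prod_lin _ fun r hr =>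
      ne_zero_of_apply_ne_zero (hξ _ _ (Γ.mem_downNbrs.1 hr).1)
  have hmap : ∀ q, Module.finrank ℝ ((degreeLE n k (Γ.index ξ q)).map
      (LinearMap.mulLeft ℝ (Γ.downProd ξ q))) = Module.finrank ℝ (degreeLE n k (Γ.index ξ q)) :=
    fun q => ((Submodule.equivMapOfInjective _
      (mul_right_injective₀ (downProd_ne_zero hξ q)) _).finrank_eq).symm
  have hle' : ∀ q ∈ Finset.univ, Module.finrank ℝ (leadingValues X φ q) ≤
      Module.finrank ℝ (degreeLE n k (Γ.index ξ q)) := fun q _ => by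
    rw [← hmap q]
    exact Submodule.finrank_mono (hle q)
  have hsum := Γ.sum_index_eq hξ hξ'.polarizing fun m => Module.finrank ℝ (degreeLE n k m)
  have hup := finrank_le_sum_leadingValues X hφ.injective
  have heq := (Finset.sum_eq_sum_iff_of_le hle').1
    (le_antisymm (Finset.sum_le_sum hle') (hsum.trans_le (hlow.trans hup))) p (Finset.mem_univ p)
  have htop : leadingValues X φ p =
      (degreeLE n k (Γ.index ξ p)).map (LinearMap.mulLeft ℝ (Γ.downProd ξ p)) :=
    Submodule.eq_of_le_of_finrank_eq (hle p) (heq.trans (hmap p).symm)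
  have h1 : Γ.downProd ξ p ∈ leadingValues X φ p := by
    rw [htop]
    refine ⟨1, Or.inr ?_, mul_one _⟩
    rw [map_one, MvPolynomial.totalDegree_one, zero_add]
  obtain ⟨f, ⟨hf, hf0⟩, hfp⟩ := h1
  exact ⟨f, (hX.1 hf).1, hf0, hfp⟩

end Family

/-! ### Extension of partially defined classes -/

section Extension

variable {n : ℕ} {V : Type*}

/-- The congruences of a cohomology class, along the edges with both endpoints in `U`. -/
def IsPartialClass (Γ : OneSkeleton n V) (U : Set V) (f : V → S n) : Prop :=
  ∀ p ∈ U, ∀ q ∈ U, Γ.graph.Adj p q → lin (Γ.α p q) ∣ f q - f p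

/-- `U` contains with each vertex all the vertices below it. -/
def IsLower (φ : V → ℝ) (U : Set V) : Prop :=
  ∀ u ∈ U, ∀ v, φ v < φ u → v ∈ U

theorem IsLower.of_insert {φ : V → ℝ} [DecidableEq V] {a : V} {s : Finset V}
    (hmax : ∀ x ∈ s, φ x ≤ φ a) (h : IsLower φ (insert a s : Finset V)) : IsLower φ (s : Set V) :=
  fun u hu v hv => Finset.mem_of_mem_insert_of_ne (h u (Finset.mem_insert_of_mem hu) v hv)
    fun hva => absurd (hmax u hu) (not_le.2 (hva ▸ hv))

theorem IsLower.mem_of_insert {φ : V → ℝ} [DecidableEq V] {a : V} {s : Finset V}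
    (h : IsLower φ (insert a s : Finset V)) {v : V} (hv : φ v < φ a) : v ∈ s :=
  Finset.mem_of_mem_insert_of_ne (h a (Finset.mem_insert_self a s) v hv)
    fun hva => absurd hv (by simp [hva])

variable {Γ : OneSkeleton n V} {ξ : (Fin n → ℝ) →ₗ[ℝ] ℝ} {φ : V → ℝ}

theorem lin_α_symm {p q : V} (h : Γ.graph.Adj p q) : lin (Γ.α p q) = -lin (Γ.α q p) := by
  rw [Γ.α_symm p q h, lin, map_neg]

theorem mem_cohomology_iff {f : V → S n} :
    f ∈ Γ.cohomology ↔ ∀ p q, Γ.graph.Adj p q → lin (Γ.α p q) ∣ f q - f p :=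
  forall_congr' fun _ => forall_congr' fun _ => forall_congr' fun _ => Ideal.mem_span_singleton

/-- Partial classes on lower sets are combinations of leading classes. -/
theorem IsPartialClass.exists_sum_smul [Fintype V] (hξ : Γ.IsPolarizing ξ)
    (hφ : Γ.IsMorseFunction ξ φ) {τ : V → V → S n} (hτ : ∀ p, Γ.IsLeadingClass ξ φ p (τ p))
    {U : Finset V} (hU : IsLower φ (U : Set V)) {f : V → S n} (hf : Γ.IsPartialClass U f) :
    ∃ s : V → S n, ∀ u ∈ U, (∑ p, s p • τ p) u = f u := by
  classical
  induction U using Finset.induction_on_max_value φ with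
  | empty => exact ⟨0, by simp⟩
  | insert a U ha hmax ih =>
    obtain ⟨s, hs⟩ := ih (hU.of_insert hmax) fun p hp q hq =>
      hf p (Finset.mem_insert_of_mem hp) q (Finset.mem_insert_of_mem hq)
    have hmem : (∑ p, s p • τ p) ∈ Γ.cohomology :=
      Subalgebra.sum_mem _ fun p _ => Subalgebra.smul_mem _ (hτ p).mem _
    -- the error at `a` is divisible by the edges that flow into `a`
    obtain ⟨t, ht⟩ : Γ.downProd ξ a ∣ f a - (∑ p, s p • τ p) a := by
      refine downProd_dvd hξ fun r hr => ?_
      obtain ⟨har, hlt⟩ := (hφ.mem_downNbrs_iff hξ).1 hr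
      have hrU := hU.mem_of_insert hlt
      have h1 := hf a (Finset.mem_insert_self a U) r (Finset.mem_insert_of_mem hrU) har
      have h2 := lin_dvd_sub_of_mem hmem har
      rw [hs r hrU] at h2
      have := dvd_sub h2 h1
      rwa [sub_sub_sub_cancel_left] at this
    refine ⟨s + Pi.single a t, fun u hu => ?_⟩
    have h1 : ∑ p, (s + Pi.single a t : V → S n) p • τ p = ∑ p, s p • τ p + t • τ a := by
      simp only [Pi.add_apply, add_smul, Finset.sum_add_distrib]
      congr 1
      rw [Finset.sum_eq_single a]
      · rw [Pi.single_eq_same]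
      · intro p _ hp
        rw [Pi.single_eq_of_ne hp, zero_smul]
      · intro h
        exact absurd (Finset.mem_univ a) h
    rw [h1, Pi.add_apply, Pi.smul_apply, smul_eq_mul]
    rcases Finset.mem_insert.1 hu with rfl | hu
    · rw [(hτ u).self, mul_comm, ← ht, add_sub_cancel]
    · have hlt : φ u < φ a := lt_of_le_of_ne (hmax u hu) fun h => ha (hφ.injective h ▸ hu)
      rw [(hτ a).eq_zero u hlt, mul_zero, add_zero, hs u hu]

/-- Extension to one more vertex.  The congruences at `q` can be solved in each `2`-slice through
`q`, where there are leading classes, and hence simultaneously. -/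
theorem IsPartialClass.exists_value [Finite V]
    (hslice : ∀ H : Submodule ℝ (Fin n → ℝ), Module.finrank ℝ H = 2 →
      ∀ C : (Γ.sliceGraph H).ConnectedComponent, (Γ.slice H C).HasMorsePackage)
    (hξ : Γ.IsPolarizing ξ) (hφ : Γ.IsMorseFunction ξ φ) {q : V} {f : V → S n}
    (hf : Γ.IsPartialClass {v | φ v < φ q} f) :
    ∃ F : S n, ∀ r, Γ.graph.Adj q r → φ r < φ q → lin (Γ.α q r) ∣ F - f r := by
  classical
  suffices h : ∃ F : S n, ∀ r ∈ Γ.downNbrs ξ q, lin (Γ.α q r) ∣ F - f r by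
    obtain ⟨F, hF⟩ := h
    exact ⟨F, fun r hr hlt => hF r ((hφ.mem_downNbrs_iff hξ).2 ⟨hr, hlt⟩)⟩
  refine exists_interpolation_of_planes (ξ := ξ)
    (fun r hr => hξ _ _ (Γ.mem_downNbrs.1 hr).1)
    (fun r hr s hs hrs => Γ.α_notMem_span (Γ.mem_downNbrs.1 hr).1 (Γ.mem_downNbrs.1 hs).1 hrs)
    fun r hr s hs hrs => ?_
  have hfin : Module.finrank ℝ (Submodule.span ℝ {Γ.α q r, Γ.α q s}) = 2 := by
    have h := finrank_span_eq_card
      (Γ.α_indep q r s (Γ.mem_downNbrs.1 hr).1 (Γ.mem_downNbrs.1 hs).1 hrs)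
    rwa [Matrix.range_cons, Matrix.range_cons, Matrix.range_empty, Set.union_empty,
      Set.singleton_union, Fintype.card_fin] at h
  generalize Submodule.span ℝ {Γ.α q r, Γ.α q s} = H at hfin
  let C := (Γ.sliceGraph H).connectedComponentMk q
  have hqC : q ∈ C := SimpleGraph.ConnectedComponent.connectedComponentMk_mem
  have hξC : (Γ.slice H C).IsPolarizing ξ := fun x y hxy => hξ x y hxy.1
  have hφC : (Γ.slice H C).IsMorseFunction ξ fun x => φ x :=
    ⟨fun x y h => Subtype.ext (hφ.injective h),
      fun x y hxy => hφ.increasing x y ⟨hxy.1.1, hxy.2⟩⟩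
  have := Fintype.ofFinite C
  choose τ hτ using fun x => (hslice H hfin C).exists_isLeadingClass hξC hφC x
  let U : Finset C := Finset.univ.filter fun x => φ x < φ q
  have hU : ∀ {x : C}, x ∈ U ↔ φ x < φ q := fun {x} => by simp [U]
  obtain ⟨t, ht⟩ := IsPartialClass.exists_sum_smul (U := U) (f := fun x => f x) hξC hφC hτ
    (fun u hu v hv => hU.2 (lt_trans hv (hU.1 hu)))
    (fun x hx y hy hxy => hf x (hU.1 hx) y (hU.1 hy) hxy.1)
  have hmem : (∑ x, t x • τ x) ∈ (Γ.slice H C).cohomology :=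
    Subalgebra.sum_mem _ fun p _ => Subalgebra.smul_mem _ (hτ p).mem _
  refine ⟨(∑ x, t x • τ x) ⟨q, hqC⟩, fun v hv hvH => ?_⟩
  obtain ⟨hqv, hlt⟩ := (hφ.mem_downNbrs_iff hξ).1 hv
  have hadj : (Γ.sliceGraph H).Adj q v := ⟨hqv, hvH⟩
  have hvC : v ∈ C := C.mem_supp_of_adj_mem_supp hqC hadj
  have h1 := lin_dvd_sub_of_mem hmem (p := ⟨q, hqC⟩) (q := ⟨v, hvC⟩) hadj
  rw [ht ⟨v, hvC⟩ (hU.2 hlt)] at h1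
  exact (dvd_sub_comm).1 h1

/-- The values of classes on a lower set are not restricted by the vertices above it. -/
theorem IsPartialClass.exists_extension [Finite V]
    (hslice : ∀ H : Submodule ℝ (Fin n → ℝ), Module.finrank ℝ H = 2 →
      ∀ C : (Γ.sliceGraph H).ConnectedComponent, (Γ.slice H C).HasMorsePackage)
    (hξ : Γ.IsPolarizing ξ) (hφ : Γ.IsMorseFunction ξ φ) {U : Finset V}
    (hU : IsLower φ (U : Set V)) {f : V → S n} (hf : Γ.IsPartialClass U f) :
    ∃ g ∈ Γ.cohomology, ∀ u ∈ U, g u = f u := by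
  classical
  have := Fintype.ofFinite V
  induction hN : Uᶜ.card generalizing U f with
  | zero =>
    refine ⟨f, mem_cohomology_iff.2 fun p q => ?_, fun _ _ => rfl⟩
    rw [Finset.card_eq_zero, Finset.compl_eq_empty_iff] at hN
    exact hf p (by simp [hN]) q (by simp [hN])
  | succ N ih =>
    obtain ⟨q, hq, hmin⟩ := Finset.exists_min_image Uᶜ φ
      (Finset.card_pos.1 (by rw [hN]; exact Nat.succ_pos N))
    rw [Finset.mem_compl] at hq
    have hUq : (U : Set V) = {v | φ v < φ q} := by
      ext v
      constructor
      · intro hv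
        change φ v < φ q
        refine lt_of_not_ge fun h => ?_
        rcases h.eq_or_lt with h1 | h1
        · exact hq (hφ.injective h1 ▸ hv)
        · exact hq (hU v hv q h1)
      · intro hv
        by_contra h
        exact absurd (hmin v (Finset.mem_compl.2 h)) (not_le.2 hv)
    obtain ⟨F, hF⟩ := IsPartialClass.exists_value hslice hξ hφ (hUq ▸ hf)
    have hup : ∀ {v}, v ∈ U → Function.update f q F v = f v := fun {v} hv =>
      Function.update_of_ne (fun h => hq (by rwa [h] at hv)) _ _
    have hlt : ∀ {v}, v ∈ U → φ v < φ q := fun {v} hv => by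
      have : v ∈ (U : Set V) := hv
      rwa [hUq] at this
    obtain ⟨g, hg, hgU⟩ := ih (U := insert q U) (f := Function.update f q F) (by
        intro u hu v hv
        rcases Finset.mem_insert.1 (Finset.mem_coe.1 hu) with rfl | hu
        · refine Finset.mem_insert_of_mem ?_
          have : v ∈ {v | φ v < φ u} := hv
          rwa [← hUq] at this
        · exact Finset.mem_insert_of_mem (hU u hu v hv)) (by
        intro x hx y hy hxy
        rcases Finset.mem_insert.1 (Finset.mem_coe.1 hx) with rfl | hxU <;>
          rcases Finset.mem_insert.1 (Finset.mem_coe.1 hy) with rfl | hyU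
        · exact absurd rfl hxy.ne
        · rw [hup hyU, Function.update_self]
          exact (dvd_sub_comm).1 (hF y hxy (hlt hyU))
        · rw [hup hxU, Function.update_self, lin_α_symm hxy, neg_dvd]
          exact hF x hxy.symm (hlt hxU)
        · rw [hup hxU, hup hyU]
          exact hf x hxU y hyU hxy) (by
        rw [Finset.compl_insert, Finset.card_erase_of_mem (Finset.mem_compl.2 hq), hN]
        rfl)
    exact ⟨g, hg, fun u hu => by rw [hgU u (Finset.mem_insert_of_mem hu), hup hu]⟩

theorem exists_isLeadingClass_of_slices [Finite V]
    (hslice : ∀ H : Submodule ℝ (Fin n → ℝ), Module.finrank ℝ H = 2 →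
      ∀ C : (Γ.sliceGraph H).ConnectedComponent, (Γ.slice H C).HasMorsePackage)
    (hξ : Γ.IsPolarizing ξ) (hφ : Γ.IsMorseFunction ξ φ) (p : V) :
    ∃ f, Γ.IsLeadingClass ξ φ p f := by
  classical
  have := Fintype.ofFinite V
  let U : Finset V := Finset.univ.filter fun v => φ v ≤ φ p
  have hU : ∀ {v}, v ∈ U ↔ φ v ≤ φ p := fun {v} => by simp [U]
  obtain ⟨g, hg, hgU⟩ := IsPartialClass.exists_extension (U := U)
    (f := Pi.single p (Γ.downProd ξ p)) hslice hξ hφ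
    (fun u hu v hv => hU.2 (hv.le.trans (hU.1 hu))) (by
      have key : ∀ y ∈ U, Γ.graph.Adj p y → lin (Γ.α p y) ∣ Γ.downProd ξ p := by
        intro y hy hpy
        refine Finset.dvd_prod_of_mem (fun q => lin (Γ.α p q))
          ((hφ.mem_downNbrs_iff hξ).2 ⟨hpy, ?_⟩)
        exact lt_of_le_of_ne (hU.1 hy) fun h => hpy.ne (hφ.injective h).symm
      intro x hx y hy hxy
      by_cases hxp : x = p
      · subst hxp
        rw [Pi.single_eq_same, Pi.single_eq_of_ne hxy.ne', zero_sub, dvd_neg]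
        exact key y hy hxy
      · by_cases hyp : y = p
        · subst hyp
          rw [Pi.single_eq_same, Pi.single_eq_of_ne hxp, sub_zero, lin_α_symm hxy, neg_dvd]
          exact key x hx hxy.symm
        · rw [Pi.single_eq_of_ne hxp, Pi.single_eq_of_ne hyp, sub_zero]
          exact dvd_zero _)
  refine ⟨g, hg, fun v hv => ?_, ?_⟩
  · rw [hgU v (hU.2 hv.le), Pi.single_eq_of_ne]
    rintro rfl
    exact lt_irrefl _ hv
  · rw [hgU p (hU.2 le_rfl), Pi.single_eq_same]

end Extension

/-! ### Existence of integration constants -/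

section Constants

variable {n : ℕ} {V : Type*} [Finite V] {Γ : OneSkeleton n V} {ξ : (Fin n → ℝ) →ₗ[ℝ] ℝ}
  {φ : V → ℝ}

/-- Transport by the connection compares the edges at the two ends of an edge, modulo that edge. -/
theorem along_prod_erase [DecidableEq V] (hξ : Γ.IsPolarizing ξ) {p q : V}
    (hpq : Γ.graph.Adj p q) :
    along ξ (Γ.α p q) (∏ r ∈ (Γ.nbrs p).erase q, lin (Γ.α p r)) =
      algebraMap ℝ (Sperp ξ) (∏ r ∈ Γ.nbrs p, Γ.lam p q r) *
        along ξ (Γ.α p q) (∏ s ∈ (Γ.nbrs q).erase p, lin (Γ.α q s)) := by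
  have hmem : ∀ {x y r : V}, r ∈ (Γ.nbrs x).erase y ↔ r ≠ y ∧ Γ.graph.Adj x r := by
    intro x y r
    rw [Finset.mem_erase, mem_nbrs]
  have hterm : ∀ r ∈ (Γ.nbrs p).erase q, along ξ (Γ.α p q) (lin (Γ.α p r)) =
      algebraMap ℝ (Sperp ξ) (Γ.lam p q r) *
        along ξ (Γ.α p q) (lin (Γ.α q (Γ.θ p q r))) := by
    intro r hr
    obtain ⟨t, ht⟩ := Γ.α_compat p q r hpq (hmem.1 hr).2
    have h1 : Γ.α p r = Γ.lam p q r • Γ.α q (Γ.θ p q r) + t • Γ.α p q := by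
      rw [← ht]; abel
    have h2 := along_self (hξ p q hpq)
    rw [h1]
    simp only [lin, map_add, map_smul] at h2 ⊢
    rw [h2, smul_zero, add_zero, Algebra.smul_def]
  have hθ : ∀ {x y : V}, Γ.graph.Adj x y → ∀ r ∈ (Γ.nbrs x).erase y,
      Γ.θ x y r ∈ (Γ.nbrs y).erase x := by
    intro x y hxy r hr
    rw [hmem] at hr ⊢
    refine ⟨fun h => hr.1 ?_, Γ.θ_adj x y r hxy hr.2⟩
    have h1 := Γ.θ_inv x y r hxy hr.2
    rw [h, Γ.θ_self y x hxy.symm] at h1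
    exact h1.symm
  have hlam : ∏ r ∈ Γ.nbrs p, Γ.lam p q r = ∏ r ∈ (Γ.nbrs p).erase q, Γ.lam p q r := by
    rw [← Finset.mul_prod_erase _ _ (Γ.mem_nbrs.2 hpq), Γ.lam_self p q hpq, one_mul]
  rw [map_prod, Finset.prod_congr rfl hterm, Finset.prod_mul_distrib, hlam, map_prod, map_prod]
  congr 1
  refine Finset.prod_nbij' (Γ.θ p q) (Γ.θ q p) (hθ hpq) (hθ hpq.symm) ?_ ?_ fun _ _ => rfl
  · intro r hr
    exact Γ.θ_inv p q r hpq (hmem.1 hr).2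
  · intro s hs
    exact Γ.θ_inv q p s hpq.symm (hmem.1 hs).2

/-- The Thom class of a vertex, supported at that vertex. -/
def vertexClass [DecidableEq V] (Γ : OneSkeleton n V) (p : V) : V → S n :=
  Pi.single p (∏ r ∈ Γ.nbrs p, lin (Γ.α p r))

/-- The Thom class of an edge, supported at its two endpoints. -/
def edgeClass [DecidableEq V] (Γ : OneSkeleton n V) (p q : V) : V → S n :=
  Pi.single p (∏ r ∈ (Γ.nbrs p).erase q, lin (Γ.α p r)) +
    Pi.single q (algebraMap ℝ (S n) (∏ r ∈ Γ.nbrs p, Γ.lam p q r) *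
      ∏ s ∈ (Γ.nbrs q).erase p, lin (Γ.α q s))

theorem vertexClass_mem [DecidableEq V] (p : V) : Γ.vertexClass p ∈ Γ.cohomology := by
  have key : ∀ y, Γ.graph.Adj p y → lin (Γ.α p y) ∣ ∏ r ∈ Γ.nbrs p, lin (Γ.α p r) :=
    fun y hy => Finset.dvd_prod_of_mem (fun r => lin (Γ.α p r)) (Γ.mem_nbrs.2 hy)
  rw [mem_cohomology_iff]
  intro x y hxy
  rw [vertexClass]
  by_cases hxp : x = p
  · subst hxp
    rw [Pi.single_eq_same, Pi.single_eq_of_ne hxy.ne', zero_sub, dvd_neg]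
    exact key y hxy
  · by_cases hyp : y = p
    · subst hyp
      rw [Pi.single_eq_same, Pi.single_eq_of_ne hxp, sub_zero, lin_α_symm hxy, neg_dvd]
      exact key x hxy.symm
    · rw [Pi.single_eq_of_ne hxp, Pi.single_eq_of_ne hyp, sub_zero]
      exact dvd_zero _

theorem edgeClass_mem [DecidableEq V] (hξ : Γ.IsPolarizing ξ) {p q : V} (hpq : Γ.graph.Adj p q) :
    Γ.edgeClass p q ∈ Γ.cohomology := by
  have key : ∀ x z y, Γ.graph.Adj x y → y ≠ z →
      lin (Γ.α x y) ∣ ∏ r ∈ (Γ.nbrs x).erase z, lin (Γ.α x r) := fun x z y hy hyz =>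
    Finset.dvd_prod_of_mem (fun r => lin (Γ.α x r))
      (Finset.mem_erase.2 ⟨hyz, Γ.mem_nbrs.2 hy⟩)
  have hp : Γ.edgeClass p q p = ∏ r ∈ (Γ.nbrs p).erase q, lin (Γ.α p r) := by
    simp [edgeClass, hpq.ne]
  have hq : Γ.edgeClass p q q = algebraMap ℝ (S n) (∏ r ∈ Γ.nbrs p, Γ.lam p q r) *
      ∏ s ∈ (Γ.nbrs q).erase p, lin (Γ.α q s) := by
    simp [edgeClass, hpq.ne']
  have h0 : ∀ {x}, x ≠ p → x ≠ q → Γ.edgeClass p q x = 0 := fun h1 h2 => by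
    simp [edgeClass, h1, h2]
  have hedge : lin (Γ.α p q) ∣ Γ.edgeClass p q q - Γ.edgeClass p q p := by
    rw [← Ideal.mem_span_singleton, ← along_eq_iff (hξ p q hpq), hp, hq, map_mul,
      AlgHom.commutes, along_prod_erase hξ hpq]
  have hsymm : ∀ {x y}, Γ.graph.Adj x y → lin (Γ.α x y) ∣ Γ.edgeClass p q y - Γ.edgeClass p q x →
      lin (Γ.α y x) ∣ Γ.edgeClass p q x - Γ.edgeClass p q y := by
    intro x y hxy h
    rwa [lin_α_symm hxy.symm, neg_dvd, dvd_sub_comm]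
  have hout : ∀ {x y}, Γ.graph.Adj x y → x = p ∨ x = q →
      lin (Γ.α x y) ∣ Γ.edgeClass p q y - Γ.edgeClass p q x := by
    rintro x y hxy (rfl | rfl)
    · by_cases hy : y = q
      · rw [hy]; exact hedge
      · rw [h0 hxy.ne' hy, zero_sub, dvd_neg, hp]
        exact key x q y hxy hy
    · by_cases hy : y = p
      · rw [hy]; exact hsymm hpq hedge
      · rw [h0 hy hxy.ne', zero_sub, dvd_neg, hq]
        exact Dvd.dvd.mul_left (key x p y hxy hy) _
  rw [mem_cohomology_iff]
  intro x y hxy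
  by_cases hx : x = p ∨ x = q
  · exact hout hxy hx
  · by_cases hy : y = p ∨ y = q
    · exact hsymm hxy.symm (hout hxy.symm hy)
    · push Not at hx hy
      rw [h0 hx.1 hx.2, h0 hy.1 hy.2, sub_zero]
      exact dvd_zero _

/-- Multiplication of the class of an edge by that edge compares the classes of its endpoints. -/
theorem lin_smul_edgeClass [DecidableEq V] {p q : V} (hpq : Γ.graph.Adj p q) :
    lin (Γ.α p q) • Γ.edgeClass p q = Γ.vertexClass p -
      algebraMap ℝ (S n) (∏ r ∈ Γ.nbrs p, Γ.lam p q r) • Γ.vertexClass q := by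
  have h1 := Finset.mul_prod_erase (Γ.nbrs p) (fun r => lin (Γ.α p r)) (Γ.mem_nbrs.2 hpq)
  have h2 := Finset.mul_prod_erase (Γ.nbrs q) (fun r => lin (Γ.α q r)) (Γ.mem_nbrs.2 hpq.symm)
  rw [vertexClass, vertexClass, edgeClass, ← h1, ← h2, smul_add, ← Pi.single_smul,
    ← Pi.single_smul, ← Pi.single_smul, sub_eq_add_neg, ← Pi.single_neg]
  congr 2
  simp only [smul_eq_mul]
  rw [lin_α_symm hpq]
  ring

/-- Leading classes form a basis of the cohomology, and the coefficient at the topmost vertex, at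
the origin, is a functional which takes proportional values on the classes of adjacent vertices; the
inverses of these values are integration constants. -/
theorem exists_isIntegrationConstants (hξ : Γ.IsPolarizing ξ) (hφ : Γ.IsMorseFunction ξ φ)
    (h : ∀ p, ∃ f, Γ.IsLeadingClass ξ φ p f) : ∃ k : V → ℝ, Γ.IsIntegrationConstants k := by
  classical
  have := Fintype.ofFinite V
  have := Γ.connected.nonempty
  choose τ hτ using h
  obtain ⟨q, hq⟩ := Finite.exists_max φ
  let b : Module.Basis V (S n) Γ.cohomology := Module.Basis.mk
    (v := fun p => (⟨τ p, (hτ p).mem⟩ : Γ.cohomology)) (by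
      rw [Fintype.linearIndependent_iff]
      intro s hs
      have hwf : WellFounded (InvImage (· < ·) φ) := by
        have : IsTrans V (InvImage (· < ·) φ) := ⟨fun _ _ _ h1 h2 => lt_trans h1 h2⟩
        have : Std.Irrefl (InvImage (· < ·) φ) := ⟨fun _ => lt_irrefl _⟩
        exact Finite.wellFounded_of_trans_of_irrefl _
      refine eq_zero_of_triangular hwf (τ := τ) (fun p => ?_) (fun p x hx => ?_) ?_
      · rw [(hτ p).self]
        exact downProd_ne_zero hξ p
      · by_contra hcon
        push Not at hcon
        have h1 : φ x ≤ φ p := not_lt.1 hcon.2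
        exact hx ((hτ p).eq_zero x (lt_of_le_of_ne h1 fun h => hcon.1 (hφ.injective h).symm))
      · have := congrArg (Subtype.val : Γ.cohomology → V → S n) hs
        simpa using this) (by
      rintro ⟨f, hf⟩ -
      obtain ⟨s, hs⟩ := IsPartialClass.exists_sum_smul (U := Finset.univ) (f := f) hξ hφ hτ
        (fun _ _ v _ => by simp) (fun x _ y _ => mem_cohomology_iff.1 hf x y)
      have : (⟨f, hf⟩ : Γ.cohomology) = ∑ p, s p • (⟨τ p, (hτ p).mem⟩ : Γ.cohomology) := by
        refine Subtype.ext (funext fun v => ?_)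
        refine (hs v (Finset.mem_univ v)).symm.trans ?_
        simp
      rw [this]
      exact Submodule.sum_mem _ fun p _ => Submodule.smul_mem _ _
        (Submodule.subset_span ⟨p, rfl⟩))
  let ε : Γ.cohomology → ℝ := fun f => SymmetricAlgebra.algebraMapInv (b.coord q f)
  let c : V → ℝ := fun p => ε ⟨Γ.vertexClass p, vertexClass_mem p⟩
  have hcq : c q = 1 := by
    have h1 : (⟨Γ.vertexClass q, vertexClass_mem q⟩ : Γ.cohomology) = b q := by
      rw [Module.Basis.mk_apply]
      refine Subtype.ext (funext fun v => ?_)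
      change Γ.vertexClass q v = τ q v
      rw [vertexClass]
      by_cases hv : v = q
      · rw [hv, Pi.single_eq_same, (hτ q).self, downProd]
        refine Finset.prod_congr (Finset.ext fun r => ?_) fun _ _ => rfl
        rw [mem_nbrs, hφ.mem_downNbrs_iff hξ]
        refine ⟨fun hr => ⟨hr, ?_⟩, fun hr => hr.1⟩
        exact lt_of_le_of_ne (hq r) fun h => hr.ne (hφ.injective h).symm
      · rw [Pi.single_eq_of_ne hv, (hτ q).eq_zero v]
        exact lt_of_le_of_ne (hq v) fun h => hv (hφ.injective h)
    simp only [c, ε, h1, Module.Basis.coord_apply, Module.Basis.repr_self, Finsupp.single_eq_same,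
      map_one]
  have hc : ∀ x y, Γ.graph.Adj x y → c x = (∏ r ∈ Γ.nbrs x, Γ.lam x y r) * c y := by
    intro x y hxy
    have h1 : (⟨Γ.vertexClass x, vertexClass_mem x⟩ : Γ.cohomology) =
        lin (Γ.α x y) • ⟨Γ.edgeClass x y, edgeClass_mem hξ hxy⟩ +
        algebraMap ℝ (S n) (∏ r ∈ Γ.nbrs x, Γ.lam x y r) •
          ⟨Γ.vertexClass y, vertexClass_mem y⟩ := by
      refine Subtype.ext ?_
      change Γ.vertexClass x = lin (Γ.α x y) • Γ.edgeClass x y +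
        algebraMap ℝ (S n) (∏ r ∈ Γ.nbrs x, Γ.lam x y r) • Γ.vertexClass y
      rw [lin_smul_edgeClass hxy, sub_add_cancel]
    simp only [c, ε]
    rw [h1, map_add, map_smul, map_smul, smul_eq_mul, smul_eq_mul, map_add, map_mul, map_mul,
      SymmetricAlgebra.algebraMapInv_ι, zero_mul, zero_add, AlgHom.commutes]
    rfl
  have hΛ : ∀ x y, Γ.graph.Adj x y → ∏ r ∈ Γ.nbrs x, Γ.lam x y r ≠ 0 := fun x y hxy =>
    Finset.prod_ne_zero_iff.2 fun r hr => (Γ.lam_pos x y r hxy (Γ.mem_nbrs.1 hr)).ne'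
  have hc0 : ∀ p, c p ≠ 0 := by
    intro p
    obtain ⟨w⟩ := Γ.connected.preconnected p q
    have : ∀ {x y} (_ : Γ.graph.Walk x y), c y ≠ 0 → c x ≠ 0 := by
      intro x y w
      induction w with
      | nil => exact id
      | cons hxy _ ih =>
        intro hy
        rw [hc _ _ hxy]
        exact mul_ne_zero (hΛ _ _ hxy) (ih hy)
    exact this w (by rw [hcq]; exact one_ne_zero)
  refine ⟨fun p => (c p)⁻¹, fun p => inv_ne_zero (hc0 p), fun x y hxy => ?_⟩
  rw [hc x y hxy, mul_inv, mul_comm _ (c y)⁻¹, mul_assoc, inv_mul_cancel₀ (hΛ x y hxy), mul_one]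

end Constants

/-! ### Integrals over cuts and the residue theorem -/

section Cuts

variable {n : ℕ} {ξ : (Fin n → ℝ) →ₗ[ℝ] ℝ} {ι : Type*} [DecidableEq ι]
  {a : ι → Fin n → ℝ} {U : Finset ι} {K : Type*} [Field K] [Algebra (Sperp ξ) K]
  [IsFractionRing (Sperp ξ) K]

/-- A product of the `a j` in the numerators removes the corresponding residues. -/
theorem IsTransverseFamily.residueSum_prod_mul (h : IsTransverseFamily ξ a U) {T : Finset ι}
    (hT : T ⊆ U) (g : ι → Sperp ξ) :
    residueSum ξ K a U (fun i => along ξ (a i) (∏ j ∈ T, lin (a j)) * g i) =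
      residueSum ξ K a (U \ T) g := by
  induction T using Finset.induction_on generalizing g with
  | empty => simp
  | insert t T ht ih =>
    have h1 : residueSum ξ K a U (fun i => along ξ (a i) (∏ j ∈ insert t T, lin (a j)) * g i) =
        residueSum ξ K a U (fun i => along ξ (a i) (∏ j ∈ T, lin (a j)) *
          (along ξ (a i) (lin (a t)) * g i)) :=
      residueSum_congr fun i _ => by rw [Finset.prod_insert ht, map_mul]; ring
    rw [h1, ih ((Finset.subset_insert t T).trans hT),
      (h.mono Finset.sdiff_subset).residueSum_lin_mul
        (Finset.mem_sdiff.2 ⟨hT (Finset.mem_insert_self t T), ht⟩), ← Finset.sdiff_insert]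

/-- If a function of pairs is alternating on a set, then in its sum over the pairs that leave the
set, the pairs inside the set may be included. -/
theorem sum_cut_eq_of_alternating {V M : Type*} [Fintype V] [DecidableEq V] [AddCommGroup M]
    {U : Finset V} {T : V → V → M} (h0 : ∀ p, T p p = 0)
    (h : ∀ p ∈ U, ∀ q ∈ U, T p q + T q p = 0) :
    ∑ p ∈ U, ∑ q ∈ Uᶜ, T p q = ∑ p ∈ U, ∑ q, T p q := by
  have h1 : ∑ p ∈ U, ∑ q ∈ U, T p q = 0 := by
    rw [← Finset.sum_product']
    refine Finset.sum_involution (fun e _ => e.swap) ?_ ?_ ?_ ?_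
    · intro e he
      rw [Finset.mem_product] at he
      exact h _ he.1 _ he.2
    · intro e _ hne heq
      refine hne ?_
      have : e.1 = e.2 := congrArg Prod.snd heq
      rw [this, h0]
    · intro e he
      rw [Finset.mem_product] at he ⊢
      exact he.symm
    · intro e _
      exact e.swap_swap
  have h2 : ∀ p, ∑ q, T p q = ∑ q ∈ U, T p q + ∑ q ∈ Uᶜ, T p q := fun p =>
    (Finset.sum_add_sum_compl U (T p)).symm
  simp only [h2, Finset.sum_add_distrib, h1, zero_add]

/-- Moving a vertex `p` across a cut. -/
theorem sum_cut_eq_sub {V M : Type*} [Fintype V] [DecidableEq V] [AddCommGroup M]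
    {U : Finset V} {p : V} (hp : p ∉ U) {T T' : V → V → M} {W : V → M}
    (h1 : ∀ r ∈ U, ∀ q ∉ insert p U, T' r q = T r q) (h2 : ∀ r ∈ U, T' r p = -W r)
    (h3 : ∀ q ∉ insert p U, T p q = W q) (h0 : W p = 0) :
    ∑ r ∈ U, ∑ q ∈ Uᶜ, T' r q =
      ∑ r ∈ insert p U, ∑ q ∈ (insert p U)ᶜ, T r q - ∑ q, W q := by
  have hc : Uᶜ = insert p (insert p U)ᶜ := by
    rw [Finset.compl_insert, Finset.insert_erase (Finset.mem_compl.2 hp)]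
  have e1 : ∑ r ∈ U, ∑ q ∈ Uᶜ, T' r q =
      ∑ r ∈ U, (-W r + ∑ q ∈ (insert p U)ᶜ, T r q) := by
    refine Finset.sum_congr rfl fun r hr => ?_
    rw [hc, Finset.sum_insert (by simp), h2 r hr]
    congr 1
    exact Finset.sum_congr rfl fun q hq => h1 r hr q (Finset.mem_compl.1 hq)
  have e2 : ∑ q ∈ (insert p U)ᶜ, T p q = ∑ q ∈ (insert p U)ᶜ, W q :=
    Finset.sum_congr rfl fun q hq => h3 q (Finset.mem_compl.1 hq)
  have e3 : ∑ q, W q = ∑ q ∈ U, W q + ∑ q ∈ (insert p U)ᶜ, W q := by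
    rw [← Finset.sum_add_sum_compl U W, hc, Finset.sum_insert (by simp), h0, zero_add]
  rw [e1, Finset.sum_insert hp, e2, e3, Finset.sum_add_distrib, Finset.sum_neg_distrib]
  abel

end Cuts

section Edges

variable {n : ℕ} {V : Type*} {Γ : OneSkeleton n V} {ξ : (Fin n → ℝ) →ₗ[ℝ] ℝ}

theorem isTransverseFamily_α [Finite V] (hξ : Γ.IsPolarizing ξ) (p : V) :
    IsTransverseFamily ξ (Γ.α p) (Γ.nbrs p) :=
  ⟨fun _ hq => hξ _ _ (Γ.mem_nbrs.1 hq),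
    fun _ hq _ hr hne => Γ.α_notMem_span (Γ.mem_nbrs.1 hq) (Γ.mem_nbrs.1 hr) hne⟩

theorem along_α_symm {p q : V} (hξ : Γ.IsPolarizing ξ) (h : Γ.graph.Adj p q) :
    along ξ (Γ.α q p) = along ξ (Γ.α p q) := by
  refine SymmetricAlgebra.algHom_ext (LinearMap.ext fun v => ?_)
  change along ξ (Γ.α q p) (lin v) = along ξ (Γ.α p q) (lin v)
  rw [along_lin (hξ q p h.symm), along_lin (hξ p q h)]
  congr 1
  refine Subtype.ext ?_
  rw [proj_coe, proj_coe, Γ.α_symm q p h.symm, map_neg, inv_neg, neg_mul, neg_smul, smul_neg,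
    neg_neg]

end Edges

section Integrals

variable {n : ℕ} {V : Type*} [Finite V] [DecidableEq V] (Γ : OneSkeleton n V)
  (ξ : (Fin n → ℝ) →ₗ[ℝ] ℝ) (K : Type*) [Field K] [Algebra (Sperp ξ) K]

open Classical in
/-- The contribution of the oriented edge `pq` to the integral; zero if `p`, `q` are not adjacent.
-/
def edgeTerm (k : V → ℝ) (p q : V) (x : Sperp ξ) : K :=
  if Γ.graph.Adj p q then
    (algebraMap (Sperp ξ) K (algebraMap ℝ (Sperp ξ) (k p)))⁻¹ *
      (algebraMap (Sperp ξ) K x / algebraMap (Sperp ξ) K (residueDen ξ (Γ.α p) (Γ.nbrs p) q))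
  else 0

/-- The integral over the oriented edges that leave `U`. -/
def cutIntegral [Fintype V] (k : V → ℝ) (U : Finset V) (g : V → V → Sperp ξ) : K :=
  ∑ p ∈ U, ∑ q ∈ Uᶜ, Γ.edgeTerm ξ K k p q (g p q)

variable {Γ ξ K} {k : V → ℝ}

theorem edgeTerm_of_adj {p q : V} (h : Γ.graph.Adj p q) (x : Sperp ξ) :
    Γ.edgeTerm ξ K k p q x = algebraMap (Sperp ξ) K x / algebraMap (Sperp ξ) K
      (algebraMap ℝ (Sperp ξ) (k p * ξ (Γ.α p q)) *
        ∏ r ∈ (Γ.nbrs p).erase q, along ξ (Γ.α p q) (lin (Γ.α p r))) := by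
  rw [edgeTerm, if_pos h, residueDen, ← div_eq_inv_mul, div_div, ← map_mul,
    map_mul (algebraMap ℝ (Sperp ξ))]
  congr 2
  ring

theorem edgeTerm_of_not_adj {p q : V} (h : ¬ Γ.graph.Adj p q) (x : Sperp ξ) :
    Γ.edgeTerm ξ K k p q x = 0 := if_neg h

theorem edgeTerm_zero (p q : V) : Γ.edgeTerm ξ K k p q 0 = 0 := by
  rw [edgeTerm, map_zero, zero_div, mul_zero, ite_self]

theorem sum_edgeTerm [Fintype V] (p : V) (g : V → Sperp ξ) :
    ∑ q, Γ.edgeTerm ξ K k p q (g q) =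
      (algebraMap (Sperp ξ) K (algebraMap ℝ (Sperp ξ) (k p)))⁻¹ *
        residueSum ξ K (Γ.α p) (Γ.nbrs p) g := by
  rw [residueSum, Finset.mul_sum,
    ← Finset.sum_subset (Finset.subset_univ (Γ.nbrs p)) fun q _ hq =>
      edgeTerm_of_not_adj (fun h => hq (Γ.mem_nbrs.2 h)) _]
  refine Finset.sum_congr rfl fun q hq => ?_
  rw [edgeTerm, if_pos (Γ.mem_nbrs.1 hq)]

theorem inv_algebraMap_eq (t : ℝ) :
    (algebraMap (Sperp ξ) K (algebraMap ℝ (Sperp ξ) t))⁻¹ =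
      algebraMap (Sperp ξ) K (algebraMap ℝ (Sperp ξ) t⁻¹) :=
  (map_inv₀ ((algebraMap (Sperp ξ) K).comp (algebraMap ℝ (Sperp ξ))) t).symm

/-- The contributions of the two orientations of an edge cancel. -/
theorem edgeTerm_symm (hξ : Γ.IsPolarizing ξ) (hk : Γ.IsIntegrationConstants k) (p q : V)
    (x : Sperp ξ) : Γ.edgeTerm ξ K k q p x = -Γ.edgeTerm ξ K k p q x := by
  by_cases h : Γ.graph.Adj p q
  · rw [edgeTerm, edgeTerm, if_pos h, if_pos h.symm, ← mul_neg, ← div_neg, ← map_neg,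
      ← div_eq_inv_mul, ← div_eq_inv_mul, div_div, div_div, ← map_mul, ← map_mul]
    congr 2
    rw [residueDen, residueDen, along_α_symm hξ h, hk.cocycle p q h, Γ.apply_α_symm ξ h,
      ← map_prod (along ξ (Γ.α p q)), ← map_prod (along ξ (Γ.α p q)), along_prod_erase hξ h,
      map_neg, map_mul]
    ring
  · rw [edgeTerm_of_not_adj h, edgeTerm_of_not_adj fun h' => h h'.symm, neg_zero]

variable [IsFractionRing (Sperp ξ) K]

/-- The residues at a vertex of a polynomial sum to a polynomial. -/
theorem sum_edgeTerm_along_mem [Fintype V] (hξ : Γ.IsPolarizing ξ) (p : V) (F : S n) :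
    ∑ q, Γ.edgeTerm ξ K k p q (along ξ (Γ.α p q) F) ∈ (algebraMap (Sperp ξ) K).range := by
  rw [sum_edgeTerm, inv_algebraMap_eq]
  exact mul_mem ⟨_, rfl⟩ ((isTransverseFamily_α hξ p).residueSum_along_mem F)

/-- The integral of a cohomology class over a cut is a polynomial: it is the sum of all residues at
the vertices on one side. -/
theorem cutIntegral_mem [Fintype V] (hξ : Γ.IsPolarizing ξ) (hk : Γ.IsIntegrationConstants k)
    (U : Finset V) {f : V → S n} (hf : f ∈ Γ.cohomology) :
    Γ.cutIntegral ξ K k U (fun p q => along ξ (Γ.α p q) (f p)) ∈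
      (algebraMap (Sperp ξ) K).range := by
  rw [cutIntegral, sum_cut_eq_of_alternating]
  · exact sum_mem fun p _ => sum_edgeTerm_along_mem hξ p (f p)
  · exact fun p => edgeTerm_of_not_adj (fun h => h.ne rfl) _
  · intro p _ q _
    by_cases h : Γ.graph.Adj p q
    · rw [along_α_symm hξ h, (along_eq_iff (hξ p q h)).2 (hf p q h), edgeTerm_symm hξ hk p q,
        add_neg_cancel]
    · rw [edgeTerm_of_not_adj h, edgeTerm_of_not_adj fun h' => h h'.symm, add_zero]

end Integrals

/-! ### Surjectivity -/

section Surjectivity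

variable {n : ℕ} {V : Type*} [Fintype V] [DecidableEq V] {Γ : OneSkeleton n V}
  {ξ : (Fin n → ℝ) →ₗ[ℝ] ℝ} {φ : V → ℝ} {k : V → ℝ} (K : Type*) [Field K] [Algebra (Sperp ξ) K]
  [IsFractionRing (Sperp ξ) K]

/-- Let `g` have polynomial integrals against all classes over the cut above the lower set `insert
a U` with top vertex `a`.  Then the values of `g` on the edges that leave `a` upward come from one
polynomial; this is tested by the classes which vanish on `U` and are divisible at `a` by the
downward edges. -/
theorem exists_along_eq_at_top
    (hslice : ∀ H : Submodule ℝ (Fin n → ℝ), Module.finrank ℝ H = 2 →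
      ∀ C : (Γ.sliceGraph H).ConnectedComponent, (Γ.slice H C).HasMorsePackage)
    (hξ : Γ.IsPolarizing ξ) (hφ : Γ.IsMorseFunction ξ φ) (hk : Γ.IsIntegrationConstants k)
    {a : V} {U : Finset V} (ha : a ∉ U) (hmax : ∀ x ∈ U, φ x ≤ φ a)
    (hU : IsLower φ (insert a U : Finset V)) {g : V → V → Sperp ξ}
    (hg : ∀ h ∈ Γ.cohomology, Γ.cutIntegral ξ K k (insert a U)
      (fun p q => g p q * along ξ (Γ.α p q) (h p)) ∈ (algebraMap (Sperp ξ) K).range) :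
    ∃ F : S n, ∀ q ∉ U, Γ.graph.Adj a q → along ξ (Γ.α a q) F = g a q := by
  have hfam := isTransverseFamily_α hξ a
  have hlt : ∀ v ∈ U, φ v < φ a := fun v hv =>
    lt_of_le_of_ne (hmax v hv) fun h => ha (hφ.injective h ▸ hv)
  have hdown : ∀ {q}, q ∈ Γ.downNbrs ξ a ↔ Γ.graph.Adj a q ∧ q ∈ U := fun {q} => by
    rw [hφ.mem_downNbrs_iff hξ]
    exact and_congr_right fun _ => ⟨fun h => hU.mem_of_insert h, hlt q⟩
  have hsub : Γ.downNbrs ξ a ⊆ Γ.nbrs a := fun q hq => Γ.mem_nbrs.2 (hdown.1 hq).1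
  obtain ⟨τ, hτ⟩ := exists_isLeadingClass_of_slices hslice hξ hφ a
  obtain ⟨F, hF⟩ := (hfam.mono (Finset.sdiff_subset (s := Γ.nbrs a)
    (t := Γ.downNbrs ξ a))).exists_along_eq (K := K) (g a) (fun G => by
      have h1 := hg ((fun _ => G) * τ) (mul_mem (Γ.cohomology.algebraMap_mem G) hτ.mem)
      have h2 : Γ.cutIntegral ξ K k (insert a U)
          (fun p q => g p q * along ξ (Γ.α p q) (((fun _ => G) * τ : V → S n) p)) =
          ∑ q, Γ.edgeTerm ξ K k a q (along ξ (Γ.α a q) (∏ r ∈ Γ.downNbrs ξ a, lin (Γ.α a r)) *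
            (g a q * along ξ (Γ.α a q) G)) := by
        rw [cutIntegral, Finset.sum_insert ha, Finset.sum_eq_zero (s := U), add_zero]
        · rw [← Finset.sum_subset (Finset.subset_univ (insert a U)ᶜ)]
          · refine Finset.sum_congr rfl fun q _ => ?_
            rw [Pi.mul_apply, hτ.self, downProd, map_mul]
            congr 1
            ring
          · intro q _ hq
            by_cases hadj : Γ.graph.Adj a q
            · have hqU : q ∈ U := by
                rw [Finset.mem_compl, not_not] at hq
                exact Finset.mem_of_mem_insert_of_ne hq hadj.ne'
              rw [map_prod, Finset.prod_eq_zero (hdown.2 ⟨hadj, hqU⟩) (along_self (hξ a q hadj)),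
                zero_mul, edgeTerm_zero]
            · exact edgeTerm_of_not_adj hadj _
        · intro p hp
          refine Finset.sum_eq_zero fun q _ => ?_
          rw [Pi.mul_apply, hτ.eq_zero p (hlt p hp), mul_zero, map_zero, mul_zero, edgeTerm_zero]
      rw [h2, sum_edgeTerm, hfam.residueSum_prod_mul hsub] at h1
      have h3 := mul_mem (show algebraMap (Sperp ξ) K (algebraMap ℝ (Sperp ξ) (k a)) ∈
        (algebraMap (Sperp ξ) K).range from ⟨_, rfl⟩) h1
      rwa [mul_inv_cancel_left₀] at h3
      exact algebraMap_fractionRing_ne_zero (algebraMap_sperp_ne_zero (hk.ne_zero a)))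
  exact ⟨F, fun q hq hadj => hF q (Finset.mem_sdiff.2 ⟨Γ.mem_nbrs.2 hadj,
    fun h => hq (hdown.1 h).2⟩)⟩

/-- Functions on a cut whose integrals against all classes are polynomials are restrictions of
classes.  The cut is moved down across its top vertex `a`: a polynomial which takes the prescribed
values on the upward edges at `a` prescribes the values on the downward edges, and the
integrals change by the sum of all residues at `a`, which is a polynomial. -/
theorem exists_mem_cohomology_along_eq
    (hslice : ∀ H : Submodule ℝ (Fin n → ℝ), Module.finrank ℝ H = 2 →
      ∀ C : (Γ.sliceGraph H).ConnectedComponent, (Γ.slice H C).HasMorsePackage)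
    (hξ : Γ.IsPolarizing ξ) (hφ : Γ.IsMorseFunction ξ φ) (hk : Γ.IsIntegrationConstants k)
    {U : Finset V} (hU : IsLower φ (U : Set V)) {g : V → V → Sperp ξ}
    (hg : ∀ h ∈ Γ.cohomology, Γ.cutIntegral ξ K k U
      (fun p q => g p q * along ξ (Γ.α p q) (h p)) ∈ (algebraMap (Sperp ξ) K).range) :
    ∃ f ∈ Γ.cohomology, ∀ p ∈ U, ∀ q ∉ U, Γ.graph.Adj p q → along ξ (Γ.α p q) (f p) = g p q := by
  induction U using Finset.induction_on_max_value φ generalizing g with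
  | empty => exact ⟨0, zero_mem _, by simp⟩
  | insert a U ha hmax ih =>
    obtain ⟨F, hF⟩ := exists_along_eq_at_top K hslice hξ hφ hk ha hmax hU hg
    let g' : V → V → Sperp ξ := fun p q => if q = a then along ξ (Γ.α p a) F else g p q
    obtain ⟨f', hf', hfg⟩ := ih (hU.of_insert hmax) (g := g') (fun h hh => by
      rw [cutIntegral, sum_cut_eq_sub ha (T := fun p q => Γ.edgeTerm ξ K k p q
          (g p q * along ξ (Γ.α p q) (h p)))
        (W := fun q => Γ.edgeTerm ξ K k a q (along ξ (Γ.α a q) (F * h a)))]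
      · exact sub_mem (hg h hh) (sum_edgeTerm_along_mem hξ a _)
      · intro r _ q hq
        have : q ≠ a := fun h => hq (h ▸ Finset.mem_insert_self a U)
        simp only [g', if_neg this]
      · intro r _
        simp only [g', if_true]
        rw [edgeTerm_symm hξ hk a r]
        by_cases hadj : Γ.graph.Adj a r
        · rw [along_α_symm hξ hadj, (along_eq_iff (hξ a r hadj)).2 (hh a r hadj), map_mul]
        · rw [edgeTerm_of_not_adj hadj, edgeTerm_of_not_adj hadj]
      · intro q hq
        by_cases hadj : Γ.graph.Adj a q
        · rw [map_mul, hF q (fun h => hq (Finset.mem_insert_of_mem h)) hadj]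
        · rw [edgeTerm_of_not_adj hadj, edgeTerm_of_not_adj hadj]
      · exact edgeTerm_of_not_adj (fun h => h.ne rfl) _)
    have hup : ∀ {v}, v ∈ U → Function.update f' a F v = f' v := fun {v} hv =>
      Function.update_of_ne (fun h => ha (by rwa [h] at hv)) _ _
    have hdvd : ∀ r ∈ U, Γ.graph.Adj r a → lin (Γ.α r a) ∣ F - f' r := by
      intro r hr hra
      have h1 := hfg r hr a ha hra
      simp only [g', if_true] at h1
      rw [← Ideal.mem_span_singleton, ← along_eq_iff (hξ r a hra), h1]
    obtain ⟨f, hf, hff⟩ := IsPartialClass.exists_extension (f := Function.update f' a F)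
      hslice hξ hφ hU (by
        intro x hx y hy hxy
        rcases Finset.mem_insert.1 (Finset.mem_coe.1 hx) with rfl | hxU <;>
          rcases Finset.mem_insert.1 (Finset.mem_coe.1 hy) with rfl | hyU
        · exact absurd rfl hxy.ne
        · rw [hup hyU, Function.update_self, lin_α_symm hxy, neg_dvd, dvd_sub_comm]
          exact hdvd y hyU hxy.symm
        · rw [hup hxU, Function.update_self]
          exact hdvd x hxU hxy
        · rw [hup hxU, hup hyU]
          exact lin_dvd_sub_of_mem hf' hxy)
    refine ⟨f, hf, fun p hp q hq hpq => ?_⟩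
    have hqU : q ∉ U := fun h => hq (Finset.mem_insert_of_mem h)
    rw [hff p hp]
    rcases Finset.mem_insert.1 hp with rfl | hpU
    · rw [Function.update_self, hF q hqU hpq]
    · have hqa : q ≠ a := fun h => hq (h ▸ Finset.mem_insert_self a U)
      rw [hup hpU, hfg p hpU q hqU hpq]
      simp only [g', if_neg hqa]

end Surjectivity

/-! ### The Kirwan map -/

section Kirwan

variable {n : ℕ} {V : Type*} {Γ : OneSkeleton n V} {ξ : (Fin n → ℝ) →ₗ[ℝ] ℝ}

theorem rho_eq_along (hξ : Γ.IsPolarizing ξ) {p q : V} (h : Γ.graph.Adj p q) :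
    Γ.rho hξ h = along ξ (Γ.α p q) := by
  rw [rho, along, dif_pos (hξ p q h)]

theorem kirwan_apply (hξ : Γ.IsPolarizing ξ) (φ : V → ℝ) (c : ℝ) (f : V → S n)
    (e : Γ.CrossVertex φ c) :
    Γ.kirwan hξ φ c f e = along ξ (Γ.α e.1.1 e.1.2) (f e.1.1) := by
  rw [kirwan, rho_eq_along]

theorem kirwan_mul (hξ : Γ.IsPolarizing ξ) (φ : V → ℝ) (c : ℝ) (f h : V → S n) :
    Γ.kirwan hξ φ c (f * h) = Γ.kirwan hξ φ c f * Γ.kirwan hξ φ c h :=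
  funext fun e => map_mul (Γ.rho hξ e.2.1) (f e.1.1) (h e.1.1)

theorem kirwan_add (hξ : Γ.IsPolarizing ξ) (φ : V → ℝ) (c : ℝ) (f h : V → S n) :
    Γ.kirwan hξ φ c (f + h) = Γ.kirwan hξ φ c f + Γ.kirwan hξ φ c h :=
  funext fun e => map_add (Γ.rho hξ e.2.1) (f e.1.1) (h e.1.1)

theorem kirwan_algebraMap_incl (hξ : Γ.IsPolarizing ξ) (φ : V → ℝ) (c : ℝ) (s : Sperp ξ) :
    Γ.kirwan hξ φ c (algebraMap (S n) (V → S n) (incl ξ s)) = algebraMap (Sperp ξ) _ s :=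
  funext fun e => by
    rw [kirwan_apply]
    exact along_incl (hξ _ _ e.2.1) s

variable [Finite V]

theorem crossIntegral_eq_cutIntegral [Fintype V] [DecidableEq V] (hξ : Γ.IsPolarizing ξ)
    {φ k : V → ℝ} {c : ℝ} (hc : c ∉ Set.range φ) {f : Γ.CrossVertex φ c → Sperp ξ}
    {g : V → V → Sperp ξ} (hfg : ∀ e, f e = g e.1.1 e.1.2) :
    Γ.crossIntegral hξ φ k c f =
      Γ.cutIntegral ξ (FractionRing (Sperp ξ)) k (Finset.univ.filter fun v => φ v < c) g := by
  classical
  let U : Finset V := Finset.univ.filter fun v => φ v < c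
  have hU : ∀ {v}, v ∈ U ↔ φ v < c := fun {v} => by simp [U]
  change _ = ∑ p ∈ U, ∑ q ∈ Uᶜ, _
  rw [← Finset.sum_product']
  refine Eq.trans ?_ (Finset.sum_filter_of_ne (p := fun e => Γ.graph.Adj e.1 e.2)
    fun e _ hne => by_contra fun h => hne (edgeTerm_of_not_adj h _))
  rw [Finset.sum_subtype (p := fun e : V × V => Γ.graph.Adj e.1 e.2 ∧ φ e.1 < c ∧ c < φ e.2)]
  · refine Finset.sum_congr rfl fun e _ => ?_
    rw [edgeTerm_of_adj e.2.1, rho_eq_along hξ e.2.1, hfg]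
    congr!
  · intro e
    rw [Finset.mem_filter, Finset.mem_product, Finset.mem_compl, hU, hU, not_lt, and_comm]
    refine and_congr_right fun _ => and_congr_right fun _ => ?_
    exact ⟨fun h => lt_of_le_of_ne h fun h' => hc ⟨_, h'.symm⟩, le_of_lt⟩

section

variable {φ k : V → ℝ} {c : ℝ}

theorem mapsTo_kirwan (hξ : Γ.IsPolarizing ξ) (hk : Γ.IsIntegrationConstants k)
    (hc : c ∉ Set.range φ) :
    Set.MapsTo (Γ.kirwan hξ φ c) (Γ.cohomology : Set (V → S n)) (Γ.crossCohomology hξ φ k c) := by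
  classical
  have := Fintype.ofFinite V
  intro f hf h hh
  rw [← kirwan_mul, crossIntegral_eq_cutIntegral hξ hc
    (g := fun p q => along ξ (Γ.α p q) ((f * h) p)) fun e => kirwan_apply hξ φ c _ e]
  exact cutIntegral_mem (K := FractionRing (Sperp ξ)) hξ hk _ (mul_mem hf hh)

theorem surjOn_kirwan
    (hslice : ∀ H : Submodule ℝ (Fin n → ℝ), Module.finrank ℝ H = 2 →
      ∀ C : (Γ.sliceGraph H).ConnectedComponent, (Γ.slice H C).HasMorsePackage)
    (hξ : Γ.IsPolarizing ξ) (hφ : Γ.IsMorseFunction ξ φ) (hk : Γ.IsIntegrationConstants k)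
    (hc : c ∉ Set.range φ) :
    Set.SurjOn (Γ.kirwan hξ φ c) (Γ.cohomology : Set (V → S n)) (Γ.crossCohomology hξ φ k c) := by
  classical
  have := Fintype.ofFinite V
  intro g hg
  let G : V → V → Sperp ξ := fun p q =>
    if h : Γ.graph.Adj p q ∧ φ p < c ∧ c < φ q then g ⟨(p, q), h⟩ else 0
  have hG : ∀ e : Γ.CrossVertex φ c, G e.1.1 e.1.2 = g e := fun e => dif_pos e.2
  obtain ⟨f, hf, hfG⟩ := exists_mem_cohomology_along_eq (FractionRing (Sperp ξ)) hslice hξ hφ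
    hk (U := Finset.univ.filter fun v => φ v < c) (g := G)
    (fun u hu v hv => by
      rw [Finset.mem_coe, Finset.mem_filter] at hu ⊢
      exact ⟨Finset.mem_univ v, hv.trans hu.2⟩)
    (fun h hh => by
      have h1 := hg h hh
      rw [crossIntegral_eq_cutIntegral hξ hc
        (g := fun p q => G p q * along ξ (Γ.α p q) (h p)) fun e => by
          rw [Pi.mul_apply, hG, kirwan_apply]] at h1
      exact h1)
  refine ⟨f, hf, funext fun e => ?_⟩
  rw [kirwan_apply, ← hG e]
  exact hfG _ (by simpa using e.2.2.1) _ (by simpa using e.2.2.2.le) e.2.1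

end

/-- The image of the cohomology under the Kirwan map, as a subalgebra; the scalars are the images of
the constant classes with values in `Sym(ker ξ)`. -/
def kirwanImage (hξ : Γ.IsPolarizing ξ) (φ : V → ℝ) (c : ℝ) :
    Subalgebra (Sperp ξ) (Γ.CrossVertex φ c → Sperp ξ) where
  carrier := Γ.kirwan hξ φ c '' (Γ.cohomology : Set (V → S n))
  mul_mem' := by
    rintro _ _ ⟨f, hf, rfl⟩ ⟨h, hh, rfl⟩
    exact ⟨f * h, mul_mem hf hh, kirwan_mul hξ φ c f h⟩
  add_mem' := by
    rintro _ _ ⟨f, hf, rfl⟩ ⟨h, hh, rfl⟩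
    exact ⟨f + h, add_mem hf hh, kirwan_add hξ φ c f h⟩
  algebraMap_mem' s := ⟨_, Γ.cohomology.algebraMap_mem (incl ξ s),
    kirwan_algebraMap_incl hξ φ c s⟩

end Kirwan

end OneSkeleton

end

theorem proposition3p3 {n : ℕ} {V : Type*} [Finite V] (Γ : OneSkeleton n V)
    (hslice : ∀ H : Submodule ℝ (Fin n → ℝ), Module.finrank ℝ H = 2 →
      ∀ C : (Γ.sliceGraph H).ConnectedComponent, (Γ.slice H C).HasMorsePackage)
    (ξ : (Fin n → ℝ) →ₗ[ℝ] ℝ) (hξ : Γ.IsGenericPolarizing ξ)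
    (φ : V → ℝ) (hφ : Γ.IsMorseFunction ξ φ) :
    (∃ k : V → ℝ, Γ.IsIntegrationConstants k) ∧
    ∀ k : V → ℝ, Γ.IsIntegrationConstants k → ∀ c : ℝ, c ∉ Set.range φ →
      Set.MapsTo (Γ.kirwan hξ.polarizing φ c) (Γ.cohomology : Set (V → OneSkeleton.S n))
        (Γ.crossCohomology hξ.polarizing φ k c) ∧
      Set.SurjOn (Γ.kirwan hξ.polarizing φ c) (Γ.cohomology : Set (V → OneSkeleton.S n))
        (Γ.crossCohomology hξ.polarizing φ k c) ∧
      ∃ A : Subalgebra (OneSkeleton.Sperp ξ) (Γ.CrossVertex φ c → OneSkeleton.Sperp ξ),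
        (A : Set (Γ.CrossVertex φ c → OneSkeleton.Sperp ξ)) =
          Γ.crossCohomology hξ.polarizing φ k c := by
  have hpol := hξ.polarizing
  refine ⟨OneSkeleton.exists_isIntegrationConstants hpol hφ fun p =>
    OneSkeleton.exists_isLeadingClass_of_slices hslice hpol hφ p, fun k hk c hc => ?_⟩
  have hmaps := OneSkeleton.mapsTo_kirwan hpol hk hc
  have hsurj := OneSkeleton.surjOn_kirwan hslice hpol hφ hk hc
  exact ⟨hmaps, hsurj, OneSkeleton.kirwanImage hpol φ c,
    Set.Subset.antisymm hmaps.image_subset hsurj⟩
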